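/- For odd integers $3\le r_1\le r_2$ and an integer $q\ge 0$, let $D_b(r_1,r_2;q)$ be the dumbbell graph: for $q\ge 1$ it consists of two vertex-disjoint cycles, of lengths $r_1$ and $r_2$, together with a path of length $q$ joining a vertex of one to a vertex of the other and meeting the two cycles only in its endpoints; for $q=0$ it consists of a cycle of length $r_1$ and a cycle of length $r_2$ that share exactly one vertex. Let $\mathrm{ex}(n,H)$ denote the maximum number of edges of a simple graph on $n$ vertices that contains no (not necessarily induced) subgraph isomorphic to $H$. Put $k=3r_1+3r_2+2q-11$. Then for every integer $n\ge k^2+k$, $$\mathrm{ex}(n,D_b(r_1,r_2;q))=\begin{cases}\left\lfloor \frac{n^2}{4}\right\rfloor+1, & q=0,\\[4pt] \left\lfloor \frac{n^2}{4}\right\rfloor+\left\lceil \frac{n}{2}\right\rceil-1, & q\ge 1.\end{cases}$$ -/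

import Mathlib

/-- The dumbbell graph `D_b(r₁, r₂; q)`, for `r₁, r₂ ≥ 3` and `q ≥ 0`: a cycle of length `r₁` and a
cycle of length `r₂` joined by a path of length `q` that meets the two cycles only in its endpoints;
for `q = 0` the two cycles share exactly one vertex. It has `r₁ + r₂ + q - 1` vertices, numbered
consecutively: the first cycle is `0, 1, …, r₁ - 1` (closed by the edge from `0` to `r₁ - 1`), the
connecting path is `r₁ - 1, r₁, …, r₁ - 1 + q`, and the second cycle is
`r₁ - 1 + q, …, r₁ + r₂ + q - 2` (closed by the edge between these two end vertices). -/
def dumbbell (r₁ r₂ q : ℕ) : SimpleGraph (Fin (r₁ + r₂ + q - 1)) :=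
  SimpleGraph.fromRel fun i j =>
    -- consecutive vertices
    i.val + 1 = j.val ∨
    -- the edge closing the first cycle
    (i.val = 0 ∧ j.val + 1 = r₁) ∨
    -- the edge closing the second cycle
    (i.val + 1 = r₁ + q ∧ j.val + 2 = r₁ + r₂ + q)

/-!
The lower bound comes from the balanced complete bipartite graph with one edge added inside a part
(`q = 0`), or with a spanning star added inside the larger part (`q ≥ 1`). Every odd cycle uses an added
edge, so two odd cycles share an edge in the first case and a vertex in the second
(`free_starredTuran`).

For the upper bound let `h = r₁ + r₂ + q - 1` be the order of the dumbbell. Since `n` is quadratic in `h`,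
deleting vertices of small degree leads to one of two situations (`exists_dense_subset`). If the process
descends below `8 * h - 17` vertices, so many surplus edges have accumulated that one finds an induced
subgraph in which any two vertices have `h - 2` common neighbours, and the dumbbell is embedded greedily
(`hasDumbbell_of_dense`). Otherwise there is an induced subgraph on `N ≥ 8 * h - 17` vertices with minimum
degree about `N / 2` and more edges than the claimed extremal number.

In such a graph any two vertices `x`, `y` are joined by a path of length three, or by two paths of
length two, avoiding any given set of at most `h - 2` vertices (`exists_path_three_or_common`). The only
obstruction would be two large vertex sets with no edges between them, and one of them would be dense
enough for the greedy embedding. Consequently two consecutive edges of a dumbbell under construction can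
always be replaced by a path of length four (`exists_replace_middle`): parity classes are preserved, and
it suffices to find two triangles joined by a path of length `0`, `1`, `2` or `3`
(`HasDumbbell.extend`).

For `q ≥ 1` Mantel's theorem and the degree condition give two disjoint triangles
(`exists_disjoint_triangles`), and counting common neighbours yields the connecting paths of lengths `1`,
`2` and `3`. For `q = 0` the seed is a bowtie. In a bowtie-free graph every triangle belongs to a book
with about `N / 2` pages, and different books are disjoint; two surplus edges give two books, and one
more application of Mantel's theorem gives a third, for which there is no room
(`hasDumbbell_three_three_zero_of_vol`).
-/

section

open Finset
open scoped Classical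

variable {V : Type*}

/-! ### Mantel's theorem on vertex subsets -/

/-- The number of neighbours of `v` in `U`; `v` itself need not lie in `U`. -/
noncomputable def degIn (G : SimpleGraph V) (U : Finset V) (v : V) : ℕ := #{w ∈ U | G.Adj v w}

/-- The sum of the degrees in the subgraph induced on `U`, that is, twice its number of edges. -/
noncomputable def vol (G : SimpleGraph V) (U : Finset V) : ℕ := ∑ v ∈ U, degIn G U v

theorem degIn_univ [Fintype V] (G : SimpleGraph V) (v : V) : degIn G univ v = #(G.neighborFinset v) := by
  rw [degIn, G.neighborFinset_eq_filter]

theorem vol_univ [Fintype V] (G : SimpleGraph V) : vol G univ = 2 * #G.edgeFinset := by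
  rw [← G.sum_degrees_eq_twice_card_edges]
  exact Finset.sum_congr rfl fun v _ => degIn_univ G v

theorem vol_eq_vol_erase_add (G : SimpleGraph V) {U : Finset V} {v : V} (hv : v ∈ U) :
    vol G U = vol G (U.erase v) + 2 * degIn G U v := by
  have h1 : ∀ w, degIn G U w = degIn G (U.erase v) w + if G.Adj v w then 1 else 0 := by
    intro w
    unfold degIn
    rw [Finset.filter_erase]
    by_cases hw : G.Adj v w
    · rw [if_pos hw, Finset.card_erase_add_one]
      simp [hv, hw.symm]
    · rw [if_neg hw, Finset.erase_eq_of_notMem, add_zero]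
      simp [hv, G.adj_comm w v, hw]
  have h2 : ∑ w ∈ U.erase v, (if G.Adj v w then 1 else 0) = degIn G U v := by
    rw [← Finset.card_filter, degIn, Finset.filter_erase, Finset.erase_eq_of_notMem]
    simp
  unfold vol
  rw [← Finset.add_sum_erase U _ hv, Finset.sum_congr rfl fun w _ => h1 w,
    Finset.sum_add_distrib, h2]
  ring

/-- Mantel's theorem for the subgraph induced on `U`. -/
theorem two_mul_vol_le_sq (G : SimpleGraph V) (U : Finset V)
    (hU : ∀ a ∈ U, ∀ b ∈ U, ∀ c ∈ U, G.Adj a b → G.Adj b c → ¬ G.Adj a c) :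
    2 * vol G U ≤ #U ^ 2 := by
  induction U using Finset.strongInduction with
  | H U ih =>
  by_cases he : ∃ u ∈ U, ∃ v ∈ U, G.Adj u v
  · obtain ⟨u, hu, v, hv, huv⟩ := he
    have hv' : v ∈ U.erase u := Finset.mem_erase.2 ⟨huv.ne', hv⟩
    have hsub : (U.erase u).erase v ⊂ U :=
      (Finset.erase_subset _ _).trans_ssubset (Finset.erase_ssubset hu)
    have := ih _ hsub fun a ha b hb c hc =>
      hU a (hsub.1 ha) b (hsub.1 hb) c (hsub.1 hc)
    rw [vol_eq_vol_erase_add G hu, vol_eq_vol_erase_add G hv']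
    have hc : #((U.erase u).erase v) + 2 = #U := by
      rw [Finset.card_erase_of_mem hv', Finset.card_erase_of_mem hu]
      have := Finset.card_pos.2 ⟨v, hv'⟩
      rw [Finset.card_erase_of_mem hu] at this
      omega
    have hd1 : degIn G (U.erase u) v + 1 = degIn G U v := by
      unfold degIn
      rw [Finset.filter_erase, Finset.card_erase_add_one]
      simp [hu, huv.symm]
    have hd2 : degIn G U u + degIn G U v ≤ #U := by
      unfold degIn
      rw [← Finset.card_union_of_disjoint]
      · exact Finset.card_le_card (Finset.union_subset (Finset.filter_subset _ _)
          (Finset.filter_subset _ _))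
      · rw [Finset.disjoint_left]
        intro w hw hw'
        rw [Finset.mem_filter] at hw hw'
        exact hU u hu v hv w hw.1 huv hw'.2 hw.2
    rw [← hc] at hd2 ⊢
    nlinarith
  · have : vol G U = 0 := by
      refine Finset.sum_eq_zero fun v hv => ?_
      rw [degIn, Finset.card_eq_zero, Finset.filter_eq_empty_iff]
      exact fun w hw h => he ⟨v, hv, w, hw, h⟩
    simp [this]

theorem exists_triangle_of_lt_vol (G : SimpleGraph V) (U : Finset V) (h : #U ^ 2 < 2 * vol G U) :
    ∃ a ∈ U, ∃ b ∈ U, ∃ c ∈ U, G.Adj a b ∧ G.Adj b c ∧ G.Adj a c := by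
  by_contra hcon
  push Not at hcon
  exact absurd (two_mul_vol_le_sq G U hcon) (by omega)

/-- More than one edge above the Mantel bound, a triangle remains after deleting the pair `xy`. -/
theorem exists_triangle_avoiding_edge (G : SimpleGraph V) (U : Finset V) {x y : V} (hxy : x ≠ y)
    (h : #U ^ 2 + 4 < 2 * vol G U) :
    ∃ a ∈ U, ∃ b ∈ U, ∃ c ∈ U, (G.Adj a b ∧ G.Adj b c ∧ G.Adj a c) ∧
      ¬ (x ∈ ({a, b, c} : Finset V) ∧ y ∈ ({a, b, c} : Finset V)) := by
  obtain ⟨G', hG'⟩ : ∃ G' : SimpleGraph V, ∀ a b, G'.Adj a b ↔ G.Adj a b ∧ s(a, b) ≠ s(x, y) :=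
    ⟨G.deleteEdges {s(x, y)}, fun a b => by simp⟩
  have hd : ∀ v, degIn G U v ≤ degIn G' U v + ((if v = x then 1 else 0) + if v = y then 1 else 0) := by
    intro v
    have : ({w ∈ U | G.Adj v w} : Finset V) ⊆ {w ∈ U | G'.Adj v w} ∪
        ((if v = x then {y} else ∅) ∪ if v = y then {x} else ∅) := by
      intro w hw
      simp only [mem_filter] at hw
      simp only [hG', mem_union, mem_filter, hw, true_and, ne_eq, Sym2.eq_iff]
      by_cases h1 : v = x ∧ w = y
      · simp [h1]
      · by_cases h2 : v = y ∧ w = x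
        · simp [h2]
        · left; tauto
    refine (Finset.card_le_card this).trans ((Finset.card_union_le _ _).trans ?_)
    refine Nat.add_le_add le_rfl ((Finset.card_union_le (if v = x then {y} else ∅) (if v = y then {x} else ∅)).trans ?_)
    split_ifs <;> simp
  have hvol : vol G U ≤ vol G' U + 2 := by
    unfold vol
    refine (Finset.sum_le_sum fun v _ => hd v).trans ?_
    rw [Finset.sum_add_distrib, Finset.sum_add_distrib, Finset.sum_ite_eq', Finset.sum_ite_eq']
    split_ifs <;> omega
  obtain ⟨a, ha, b, hb, c, hc, h1, h2, h3⟩ := exists_triangle_of_lt_vol G' U (by omega)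
  simp only [hG', ne_eq, Sym2.eq_iff] at h1 h2 h3
  refine ⟨a, ha, b, hb, c, hc, ⟨h1.1, h2.1, h3.1⟩, ?_⟩
  simp only [Finset.mem_insert, Finset.mem_singleton]
  grind

/-- Successive vertex deletion: if `P` holds for the number of vertices and the degree sum of `G`,
then it holds on some vertex set from which no single vertex can be deleted without losing `P`. -/
theorem exists_minimal_finset [Fintype V] (G : SimpleGraph V) (P : ℕ → ℕ → Prop)
    (h : P #(univ : Finset V) (vol G univ)) :
    ∃ U : Finset V, P #U (vol G U) ∧ ∀ v ∈ U, ¬ P #(U.erase v) (vol G (U.erase v)) := by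
  obtain ⟨U, hU, hmin⟩ := Finset.exists_min_image
    (univ.filter fun U : Finset V => P #U (vol G U)) (fun U => #U) ⟨univ, by simpa using h⟩
  rw [mem_filter] at hU
  refine ⟨U, hU.2, fun v hv hP => ?_⟩
  have := hmin (U.erase v) (by simpa using hP)
  have := Finset.card_erase_lt_of_mem hv
  omega

theorem degIn_induce (G : SimpleGraph V) (U : Finset V) (v : (U : Set V)) :
    degIn (G.induce (U : Set V)) univ v = degIn G U v := by
  unfold degIn
  rw [← Finset.card_map (Function.Embedding.subtype _)]
  congr 1
  ext w
  simp [and_comm]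

theorem vol_induce (G : SimpleGraph V) (U : Finset V) :
    vol (G.induce (U : Set V)) univ = vol G U := by
  unfold vol
  simp_rw [degIn_induce]
  exact Finset.sum_coe_sort U (degIn G U)

/-! ### Dumbbells as lists, and the greedy construction -/

/-- The three lists form a dumbbell in `G`: read one after the other they are a path, `A` together with
the first vertex of `M` is the first cycle, `M` is the connecting path with both its ends, and the
last vertex of `M` together with `B` is the second cycle. If `M` is a single vertex, the cycles share
it. -/
structure IsDumbbell (G : SimpleGraph V) (A M B : List V) : Prop where
  nodup : (A ++ M ++ B).Nodup
  chain : (A ++ M ++ B).IsChain G.Adj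
  adj_left : ∀ a ∈ A.head?, ∀ m ∈ M.head?, G.Adj a m
  adj_right : ∀ m ∈ M.getLast?, ∀ b ∈ B.getLast?, G.Adj m b

/-- `G` contains a dumbbell with cycles of lengths `r₁` and `r₂` and a connecting path of length `q`. -/
def HasDumbbell (G : SimpleGraph V) (r₁ r₂ q : ℕ) : Prop :=
  ∃ A M B : List V, IsDumbbell G A M B ∧
    A.length + 1 = r₁ ∧ M.length = q + 1 ∧ B.length + 1 = r₂

theorem IsDumbbell.reverse {G : SimpleGraph V} {A M B : List V} (h : IsDumbbell G A M B) :
    IsDumbbell G B.reverse M.reverse A.reverse where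
  nodup := by
    have := List.nodup_reverse.2 h.nodup
    simpa [List.reverse_append] using this
  chain := by
    have : (A ++ M ++ B).reverse.IsChain G.Adj := by
      rw [List.isChain_reverse]
      exact h.chain.imp fun _ _ h => h.symm
    simpa [List.reverse_append] using this
  adj_left := by
    simpa using fun a ha m hm => (h.adj_right m hm a ha).symm
  adj_right := by
    simpa using fun a ha m hm => (h.adj_left m hm a ha).symm

theorem HasDumbbell.symm {G : SimpleGraph V} {r₁ r₂ q : ℕ} (h : HasDumbbell G r₁ r₂ q) :
    HasDumbbell G r₂ r₁ q := by
  obtain ⟨A, M, B, h, h1, h2, h3⟩ := h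
  exact ⟨_, _, _, h.reverse, by simpa, by simpa, by simpa⟩

theorem HasDumbbell.isContained {G : SimpleGraph V} {r₁ r₂ q : ℕ} (h : HasDumbbell G r₁ r₂ q)
    (hr₁ : 2 ≤ r₁) (hr₂ : 2 ≤ r₂) : SimpleGraph.IsContained (dumbbell r₁ r₂ q) G := by
  obtain ⟨A, M, B, h, h1, h2, h3⟩ := h
  have hlen : (A ++ M ++ B).length = r₁ + r₂ + q - 1 := by
    simp only [List.length_append]; omega
  let f : Fin (r₁ + r₂ + q - 1) → V := fun i => (A ++ M ++ B)[i.val]'(by rw [hlen]; exact i.isLt)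
  have hf : ∀ i j : Fin (r₁ + r₂ + q - 1), (i.val + 1 = j.val ∨ (i.val = 0 ∧ j.val + 1 = r₁) ∨
      (i.val + 1 = r₁ + q ∧ j.val + 2 = r₁ + r₂ + q)) → G.Adj (f i) (f j) := by
    rintro ⟨i, hi⟩ ⟨j, hj⟩ (hij | ⟨hi0, hj1⟩ | ⟨hi1, hj1⟩)
    · simp only at hij
      subst hij
      exact h.chain.getElem i (by rw [hlen]; exact hj)
    · simp only at hi0 hj1
      apply h.adj_left
      · simp only [f, Option.mem_def, List.head?_eq_getElem?]
        rw [List.getElem_append_left (by simp; omega), List.getElem_append_left (by omega)]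
        simp [hi0]
      · simp only [f, Option.mem_def, List.head?_eq_getElem?]
        rw [List.getElem_append_left (by simp; omega), List.getElem_append_right (by omega)]
        rw [List.getElem?_eq_some_iff]
        exact ⟨by omega, by congr 1; omega⟩
    · simp only at hi1 hj1
      apply h.adj_right
      · simp only [f, Option.mem_def, List.getLast?_eq_getElem?]
        rw [List.getElem_append_left (by simp; omega), List.getElem_append_right (by omega)]
        rw [List.getElem?_eq_some_iff]
        exact ⟨by omega, by congr 1; omega⟩
      · simp only [f, Option.mem_def, List.getLast?_eq_getElem?]
        rw [List.getElem_append_right (by simp; omega)]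
        rw [List.getElem?_eq_some_iff]
        exact ⟨by omega, by congr 1; simp; omega⟩
  refine ⟨⟨⟨f, ?_⟩, ?_⟩⟩
  · intro i j hij
    rw [dumbbell, SimpleGraph.fromRel_adj] at hij
    rcases hij.2 with h' | h'
    · exact hf i j h'
    · exact (hf j i h').symm
  · intro i j hij
    exact Fin.ext ((List.Nodup.getElem_inj_iff h.nodup).1 hij)

/-- The list `l` is a path of `G` inside the vertex set `A`. -/
structure IsPathIn (G : SimpleGraph V) (A : Finset V) (l : List V) : Prop where
  mem : ∀ a ∈ l, a ∈ A
  nodup : l.Nodup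
  chain : l.IsChain G.Adj

theorem IsPathIn.cons {G : SimpleGraph V} {A : Finset V} {v z : V} {l : List V}
    (h : IsPathIn G A (z :: l)) (hv : v ∈ A) (hvl : v ∉ z :: l) (hvz : G.Adj v z) :
    IsPathIn G A (v :: z :: l) where
  mem := by
    intro a ha
    rcases List.mem_cons.1 ha with rfl | ha
    exacts [hv, h.mem a ha]
  nodup := List.nodup_cons.2 ⟨hvl, h.nodup⟩
  chain := List.isChain_cons_cons.2 ⟨hvz, h.chain⟩

/-- A path with fewer than `h` vertices, in a set where every degree is at least `h - 1`, can be
prolonged beyond its first vertex. -/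
theorem IsPathIn.exists_append {G : SimpleGraph V} {A : Finset V} {h : ℕ}
    (hA : ∀ a ∈ A, h ≤ degIn G A a + 1) {z : V} {l : List V} (hl : IsPathIn G A (z :: l))
    (k : ℕ) (hk : k + (z :: l).length ≤ h) :
    ∃ L : List V, L.length = k ∧ IsPathIn G A (L ++ z :: l) := by
  induction k with
  | zero => exact ⟨[], rfl, hl⟩
  | succ k ih =>
    obtain ⟨L, hL, hp⟩ := ih (by omega)
    obtain ⟨w, l', hw⟩ : ∃ w l', L ++ z :: l = w :: l' := by
      cases L with
      | nil => exact ⟨z, l, rfl⟩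
      | cons a L => exact ⟨a, L ++ z :: l, rfl⟩
    have hlen : l'.length + 1 = k + (z :: l).length := by
      rw [← hL, ← List.length_append, hw, List.length_cons]
    rw [hw] at hp
    obtain ⟨v, hv, hvl⟩ : ∃ v ∈ ({v ∈ A | G.Adj w v} : Finset V), v ∉ l'.toFinset := by
      apply Finset.exists_mem_notMem_of_card_lt_card
      have h1 := hA w (hp.mem w (by simp))
      have h2 := l'.toFinset_card_le
      unfold degIn at h1
      omega
    rw [mem_filter] at hv
    refine ⟨v :: L, by simp [hL], ?_⟩
    rw [List.cons_append, hw]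
    refine hp.cons hv.1 ?_ hv.2.symm
    simp only [List.mem_toFinset] at hvl
    simp [hvl, hv.2.ne']

/-- A path on fewer than `h` vertices, in a set where any two vertices have at least `h - 2` common
neighbours, can be prolonged by a vertex that closes a cycle at a prescribed vertex `y`. -/
theorem IsPathIn.exists_closing {G : SimpleGraph V} {A : Finset V} {h : ℕ}
    (hA : ∀ a ∈ A, ∀ b ∈ A, a ≠ b → h ≤ #{v ∈ A | G.Adj a v ∧ G.Adj b v} + 2)
    {y : V} {L l : List V} (hl : IsPathIn G A (L ++ y :: l)) (hL : L ≠ [])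
    (hlen : (L ++ y :: l).length < h) :
    ∃ v, G.Adj v y ∧ IsPathIn G A (v :: (L ++ y :: l)) := by
  obtain ⟨z, L, rfl⟩ := List.exists_cons_of_ne_nil hL
  have hzy : z ≠ y := by
    have := hl.nodup
    rw [List.cons_append, List.nodup_cons] at this
    rintro rfl
    simp at this
  obtain ⟨v, hv, hvl⟩ : ∃ v ∈ A.filter (fun v => G.Adj z v ∧ G.Adj y v),
      v ∉ (L ++ l).toFinset := by
    apply Finset.exists_mem_notMem_of_card_lt_card
    have h1 := hA z (hl.mem z (by simp)) y (hl.mem y (by simp)) hzy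
    have h2 := (L ++ l).toFinset_card_le
    simp only [List.length_append, List.length_cons] at hlen h2
    omega
  rw [mem_filter] at hv
  refine ⟨v, hv.2.2.symm, hl.cons hv.1 ?_ hv.2.1.symm⟩
  simp only [List.mem_toFinset, List.mem_append, not_or] at hvl
  simp [hvl, hv.2.1.ne', hv.2.2.ne']

/-- If all degrees inside `A` are at least `(#A + h - 2) / 2`, where `h` is the number of vertices of the
dumbbell, then any two vertices of `A` have `h - 2` common neighbours in `A`, and the dumbbell can be
built greedily, vertex by vertex. -/
theorem hasDumbbell_of_dense {G : SimpleGraph V} {A : Finset V} (hne : A.Nonempty)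
    {r₁ r₂ q : ℕ} (hr₁ : 3 ≤ r₁) (hr₂ : 3 ≤ r₂)
    (hA : ∀ a ∈ A, #A + (r₁ + r₂ + q - 1) ≤ 2 * degIn G A a + 2) :
    HasDumbbell G r₁ r₂ q := by
  set h := r₁ + r₂ + q - 1 with hh
  have hdeg : ∀ a ∈ A, h ≤ degIn G A a + 1 := by
    intro a ha
    have h1 : degIn G A a < #A := by
      refine Finset.card_lt_card ⟨Finset.filter_subset _ _, fun hs => ?_⟩
      simpa using hs ha
    have := hA a ha
    omega
  have hcodeg : ∀ a ∈ A, ∀ b ∈ A, a ≠ b → h ≤ #{v ∈ A | G.Adj a v ∧ G.Adj b v} + 2 := by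
    intro a ha b hb _
    have h1 := Finset.card_union_add_card_inter ({v ∈ A | G.Adj a v} : Finset V)
      {v ∈ A | G.Adj b v}
    have h2 : #(({v ∈ A | G.Adj a v} : Finset V) ∪ {v ∈ A | G.Adj b v}) ≤ #A :=
      Finset.card_le_card (Finset.union_subset (Finset.filter_subset _ _)
        (Finset.filter_subset _ _))
    rw [← Finset.filter_and] at h1
    have h3 := hA a ha
    have h4 := hA b hb
    unfold degIn at h3 h4
    omega
  obtain ⟨v₀, hv₀⟩ := hne
  have hp₀ : IsPathIn G A [v₀] := ⟨by simpa, by simp, by simp⟩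
  obtain ⟨L₁, hL₁, hp₁⟩ := hp₀.exists_append hdeg (r₂ - 2) (by simp; omega)
  obtain ⟨m, hm, hp₂⟩ := hp₁.exists_closing hcodeg
    (by rw [← List.length_pos_iff]; omega) (by simp; omega)
  obtain ⟨L₂, hL₂, hp₃⟩ := hp₂.exists_append hdeg q (by simp; omega)
  obtain ⟨z, L₂', hz⟩ : ∃ z L₂', L₂ ++ [m] = z :: L₂' := by
    cases L₂ with
    | nil => exact ⟨m, [], rfl⟩
    | cons a L => exact ⟨a, L ++ [m], rfl⟩
  have hzlen : L₂'.length = q := by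
    have := congrArg List.length hz
    simp at this
    omega
  have hz' : L₂ ++ m :: (L₁ ++ [v₀]) = z :: (L₂' ++ (L₁ ++ [v₀])) := by
    rw [← List.cons_append (a := z), ← hz]; simp
  rw [hz'] at hp₃
  obtain ⟨L₃, hL₃, hp₄⟩ := hp₃.exists_append hdeg (r₁ - 2) (by simp; omega)
  obtain ⟨b, hb, hp₅⟩ := hp₄.exists_closing hcodeg
    (by rw [← List.length_pos_iff]; omega) (by simp; omega)
  have heq : b :: (L₃ ++ z :: (L₂' ++ (L₁ ++ [v₀]))) =
      (b :: L₃) ++ (L₂ ++ [m]) ++ (L₁ ++ [v₀]) := by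
    rw [hz]; simp
  rw [heq] at hp₅
  refine ⟨b :: L₃, L₂ ++ [m], L₁ ++ [v₀], ⟨hp₅.nodup, hp₅.chain, ?_, ?_⟩, ?_, ?_, ?_⟩
  · rw [hz]; simpa using hb
  · simpa using hm
  · simp; omega
  · simp; omega
  · simp; omega

/-! ### Lengthening cycles and paths by two -/

/-- Two large vertex sets without edges between them leave few other vertices, so the minimum degree
condition forces the smaller of the two to be dense enough for the greedy construction. -/
theorem hasDumbbell_of_separated [Fintype V] {G : SimpleGraph V} {r₁ r₂ q : ℕ}
    (hr₁ : 3 ≤ r₁) (hr₂ : 3 ≤ r₂)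
    (hδ : ∀ v, Fintype.card V ≤ 2 * degIn G univ v + 1) {A B : Finset V}
    (hA : A.Nonempty) (hB : B.Nonempty) (hAB : Disjoint A B)
    (hno : ∀ a ∈ A, ∀ b ∈ B, ¬ G.Adj a b)
    (hcard : 2 * (r₁ + r₂ + q - 1) + 2 * Fintype.card V ≤ 3 * (#A + #B) + 2) :
    HasDumbbell G r₁ r₂ q := by
  wlog hle : #A ≤ #B generalizing A B
  · exact this hB hA hAB.symm (fun b hb a ha h => hno a ha b hb h.symm) (by omega) (by omega)
  refine hasDumbbell_of_dense hA hr₁ hr₂ fun a ha => ?_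
  -- a vertex of `A` has all its neighbours in `A` or among the vertices outside `A ∪ B`
  have h1 : degIn G univ a ≤ degIn G A a + #(A ∪ B)ᶜ := by
    unfold degIn
    refine le_trans (Finset.card_le_card ?_) (Finset.card_union_le _ _)
    intro w hw
    simp only [mem_filter, mem_univ, true_and] at hw
    simp only [mem_union, mem_filter, mem_compl, hw, and_true]
    have := fun hb => hno a ha w hb hw
    tauto
  have h2 := Finset.card_add_card_compl (A ∪ B)
  rw [Finset.card_union_of_disjoint hAB] at h2
  have h3 := hδ a
  omega

/-- In a dumbbell-free graph of minimum degree about half the order, any two vertices are joined by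
a path of length three or by two paths of length two, with inner vertices outside a given small
set `S`. Otherwise there is no edge between `N(x) \ S` and `N(y) \ S`. If these two sets are disjoint,
`hasDumbbell_of_separated` applies. If they meet in `a`, then `a` has no neighbour in their union, so
the union has at most about half of all vertices and the intersection is large. -/
theorem exists_path_three_or_common [Fintype V] {G : SimpleGraph V} {r₁ r₂ q : ℕ}
    (hr₁ : 3 ≤ r₁) (hr₂ : 3 ≤ r₂) (hfree : ¬ HasDumbbell G r₁ r₂ q)
    (hδ : ∀ v, Fintype.card V ≤ 2 * degIn G univ v + 1)
    (hN : 8 * (r₁ + r₂ + q - 1) ≤ Fintype.card V + 17)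
    {S : Finset V} (hS : #S + 2 ≤ r₁ + r₂ + q - 1) {x y : V} (hx : x ∈ S) (hy : y ∈ S) :
    (∃ a b, a ∉ S ∧ b ∉ S ∧ G.Adj x a ∧ G.Adj a b ∧ G.Adj b y) ∨
      2 ≤ #{z ∈ Sᶜ | G.Adj x z ∧ G.Adj y z} := by
  by_contra hcon
  rw [not_or] at hcon
  obtain ⟨hcon, hlt⟩ := hcon
  push Not at hcon
  have hsize : ∀ v ∈ S, degIn G univ v + 1 ≤ #{z ∈ Sᶜ | G.Adj v z} + #S := by
    intro v hv
    rw [← Finset.card_erase_add_one hv, ← add_assoc, Nat.add_le_add_iff_right]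
    unfold degIn
    refine le_trans (Finset.card_le_card ?_) (Finset.card_union_le _ _)
    intro w hw
    simp only [mem_filter, mem_univ, true_and] at hw
    simp only [mem_union, mem_filter, mem_compl, mem_erase, hw, and_true, hw.ne', ne_eq,
      not_false_eq_true, true_and]
    tauto
  have hAx := hsize x hx
  have hBy := hsize y hy
  have hno : ∀ a ∈ ({z ∈ Sᶜ | G.Adj x z} : Finset V), ∀ b ∈ ({z ∈ Sᶜ | G.Adj y z} : Finset V),
      ¬ G.Adj a b := by
    intro a ha b hb hab
    simp only [mem_filter, mem_compl] at ha hb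
    exact hcon a b ha.1 hb.1 ha.2 hab hb.2.symm
  have hinter : ({z ∈ Sᶜ | G.Adj x z} : Finset V) ∩ {z ∈ Sᶜ | G.Adj y z} =
      {z ∈ Sᶜ | G.Adj x z ∧ G.Adj y z} := (Finset.filter_and _ _ _).symm
  have h1 := hδ x
  have h2 := hδ y
  by_cases hd : Disjoint ({z ∈ Sᶜ | G.Adj x z} : Finset V) {z ∈ Sᶜ | G.Adj y z}
  · refine hfree (hasDumbbell_of_separated hr₁ hr₂ hδ ?_ ?_ hd hno (by omega))
    · rw [← Finset.card_pos]; omega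
    · rw [← Finset.card_pos]; omega
  · rw [Finset.not_disjoint_iff] at hd
    obtain ⟨a, ha, hb⟩ := hd
    have h3 : degIn G univ a + #(({z ∈ Sᶜ | G.Adj x z} : Finset V) ∪ {z ∈ Sᶜ | G.Adj y z}) ≤
        Fintype.card V := by
      unfold degIn
      rw [← Finset.card_union_of_disjoint]
      · exact Finset.card_le_univ _
      · rw [Finset.disjoint_left]
        intro w hw hw'
        simp only [mem_filter, mem_univ, true_and] at hw
        rcases Finset.mem_union.1 hw' with h | h
        · exact hno w h a hb hw.symm
        · exact hno a ha w h hw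
    have h4 := Finset.card_union_add_card_inter ({z ∈ Sᶜ | G.Adj x z} : Finset V)
      {z ∈ Sᶜ | G.Adj y z}
    rw [hinter] at h4
    have h5 := hδ a
    omega

/-- Two consecutive edges `ab`, `bc` of a path on at most `h - 2` vertices can be replaced by a path of
length four from `a` to `c`: substitute a path of length three for one of the edges, or, if neither
edge allows it, a path of length two for each. -/
theorem exists_replace_middle [Fintype V] {G : SimpleGraph V} {r₁ r₂ q : ℕ}
    (hr₁ : 3 ≤ r₁) (hr₂ : 3 ≤ r₂) (hfree : ¬ HasDumbbell G r₁ r₂ q)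
    (hδ : ∀ v, Fintype.card V ≤ 2 * degIn G univ v + 1)
    (hN : 8 * (r₁ + r₂ + q - 1) ≤ Fintype.card V + 17)
    {l l' : List V} {a b c : V} (hnd : (l ++ a :: b :: c :: l').Nodup)
    (hch : (l ++ a :: b :: c :: l').IsChain G.Adj)
    (hlen : (l ++ a :: b :: c :: l').length + 2 ≤ r₁ + r₂ + q - 1) :
    ∃ u v w, (l ++ a :: u :: v :: w :: c :: l').Nodup ∧
      (l ++ a :: u :: v :: w :: c :: l').IsChain G.Adj := by
  obtain ⟨S, hSdef⟩ : ∃ S : Finset V, S = (l ++ a :: b :: c :: l').toFinset := ⟨_, rfl⟩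
  have hS : #S + 2 ≤ r₁ + r₂ + q - 1 := by
    rw [hSdef]
    exact (Nat.add_le_add_right (List.toFinset_card_le _) 2).trans hlen
  have hmem : ∀ x, x ∈ S ↔ x ∈ l ∨ x = a ∨ x = b ∨ x = c ∨ x ∈ l' := by
    intro x
    rw [hSdef, List.mem_toFinset]
    simp only [List.mem_append, List.mem_cons]
  have key : ∀ u v w, G.Adj a u → G.Adj u v → G.Adj v w → G.Adj w c →
      (u = b ∨ u ∉ S) → (v = b ∨ v ∉ S) → (w = b ∨ w ∉ S) → u ≠ w →
      (l ++ a :: u :: v :: w :: c :: l').Nodup ∧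
      (l ++ a :: u :: v :: w :: c :: l').IsChain G.Adj := by
    intro u v w hau huv hvw hwc hu hv hw huw
    constructor
    · have h1 := huv.ne
      have h2 := hvw.ne
      simp only [hmem] at hu hv hw
      simp only [List.nodup_append, List.nodup_cons, List.mem_cons] at hnd ⊢
      have := hnd.2.2
      refine ⟨hnd.1, ⟨?_, ?_, ?_, ?_, hnd.2.1.2.2⟩, ?_⟩
      · grind
      · grind
      · grind
      · grind
      · intro x hx y hy
        grind
    · rw [List.isChain_append] at hch ⊢
      simp only [List.isChain_cons_cons] at hch ⊢
      exact ⟨hch.1, ⟨hau, huv, hvw, hwc, hch.2.1.2.2⟩, hch.2.2⟩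
  have hab : G.Adj a b := by
    rw [List.isChain_append] at hch
    exact (List.isChain_cons_cons.1 hch.2.1).1
  have hbc : G.Adj b c := by
    rw [List.isChain_append] at hch
    exact (List.isChain_cons_cons.1 (List.isChain_cons_cons.1 hch.2.1).2).1
  have ha : a ∈ S := by simp [hmem]
  have hb : b ∈ S := by simp [hmem]
  have hc : c ∈ S := by simp [hmem]
  rcases exists_path_three_or_common hr₁ hr₂ hfree hδ hN hS ha hb with
    ⟨u, v, hu, hv, h1, h2, h3⟩ | h1
  · exact ⟨u, v, b, key u v b h1 h2 h3 hbc (.inr hu) (.inr hv) (.inl rfl) (by grind)⟩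
  rcases exists_path_three_or_common hr₁ hr₂ hfree hδ hN hS hb hc with
    ⟨v, w, hv, hw, h2, h3, h4⟩ | h2
  · exact ⟨b, v, w, key b v w hab h2 h3 h4 (.inl rfl) (.inr hv) (.inr hw) (by grind)⟩
  obtain ⟨u, hu⟩ := Finset.card_pos.1 (lt_of_lt_of_le two_pos h1)
  obtain ⟨w, hw, hne⟩ := Finset.exists_mem_ne (lt_of_lt_of_le one_lt_two h2) u
  simp only [mem_filter, mem_compl] at hu hw
  exact ⟨u, b, w, key u b w hu.2.1 hu.2.2.symm hw.2.1 hw.2.2.symm (.inr hu.1) (.inl rfl)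
    (.inr hw.1) hne.symm⟩

/-- A cycle of a dumbbell smaller than the forbidden one can be lengthened by two. -/
theorem HasDumbbell.add_two_left [Fintype V] {G : SimpleGraph V} {r₁ r₂ q : ℕ}
    (hr₁ : 3 ≤ r₁) (hr₂ : 3 ≤ r₂) (hfree : ¬ HasDumbbell G r₁ r₂ q)
    (hδ : ∀ v, Fintype.card V ≤ 2 * degIn G univ v + 1)
    (hN : 8 * (r₁ + r₂ + q - 1) ≤ Fintype.card V + 17) {s₁ s₂ p : ℕ}
    (h : HasDumbbell G s₁ s₂ p) (hs₁ : 3 ≤ s₁) (hle : s₁ + s₂ + p + 2 ≤ r₁ + r₂ + q) :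
    HasDumbbell G (s₁ + 2) s₂ p := by
  obtain ⟨A, M, B, h, h1, h2, h3⟩ := h
  obtain ⟨a, b, A', rfl⟩ : ∃ a b A', A = a :: b :: A' := by
    match A, h1 with
    | a :: b :: A', _ => exact ⟨a, b, A', rfl⟩
    | [a], h1 => simp at h1; omega
    | [], h1 => simp at h1; omega
  obtain ⟨c, l', hl'⟩ : ∃ c l', A' ++ M ++ B = c :: l' := by
    apply List.exists_cons_of_ne_nil
    rw [← List.length_pos_iff]
    simp; omega
  have heq : (a :: b :: A') ++ M ++ B = [] ++ a :: b :: c :: l' := by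
    simp [← hl']
  have hlen : ([] ++ a :: b :: c :: l').length + 2 ≤ r₁ + r₂ + q - 1 := by
    rw [← heq]
    simp only [List.length_append, List.length_cons] at *
    omega
  obtain ⟨u, v, w, hnd, hch⟩ := exists_replace_middle hr₁ hr₂ hfree hδ hN (heq ▸ h.nodup)
    (heq ▸ h.chain) hlen
  have heq' : [] ++ a :: u :: v :: w :: c :: l' = (a :: u :: v :: w :: A') ++ M ++ B := by
    simp [← hl']
  rw [heq'] at hnd hch
  refine ⟨a :: u :: v :: w :: A', M, B, ⟨hnd, hch, ?_, h.adj_right⟩, ?_, h2, h3⟩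
  · simpa using h.adj_left
  · simp at h1 ⊢; omega

/-- A connecting path of length at least two can be lengthened by two. -/
theorem HasDumbbell.add_two_middle [Fintype V] {G : SimpleGraph V} {r₁ r₂ q : ℕ}
    (hr₁ : 3 ≤ r₁) (hr₂ : 3 ≤ r₂) (hfree : ¬ HasDumbbell G r₁ r₂ q)
    (hδ : ∀ v, Fintype.card V ≤ 2 * degIn G univ v + 1)
    (hN : 8 * (r₁ + r₂ + q - 1) ≤ Fintype.card V + 17) {s₁ s₂ p : ℕ}
    (h : HasDumbbell G s₁ s₂ p) (hp : 2 ≤ p) (hle : s₁ + s₂ + p + 2 ≤ r₁ + r₂ + q) :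
    HasDumbbell G s₁ s₂ (p + 2) := by
  obtain ⟨A, M, B, h, h1, h2, h3⟩ := h
  obtain ⟨a, b, c, M', rfl⟩ : ∃ a b c M', M = a :: b :: c :: M' := by
    match M, h2 with
    | a :: b :: c :: M', _ => exact ⟨a, b, c, M', rfl⟩
    | [a, b], h2 => simp at h2; omega
    | [a], h2 => simp at h2; omega
    | [], h2 => simp at h2
  have heq : A ++ (a :: b :: c :: M') ++ B = A ++ a :: b :: c :: (M' ++ B) := by simp
  have hlen : (A ++ a :: b :: c :: (M' ++ B)).length + 2 ≤ r₁ + r₂ + q - 1 := by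
    rw [← heq]
    simp only [List.length_append, List.length_cons] at *
    omega
  obtain ⟨u, v, w, hnd, hch⟩ := exists_replace_middle hr₁ hr₂ hfree hδ hN (heq ▸ h.nodup)
    (heq ▸ h.chain) hlen
  refine ⟨A, a :: u :: v :: w :: c :: M', B, ⟨by simpa using hnd, by simpa using hch, ?_, ?_⟩,
    h1, ?_, h3⟩
  · simpa using h.adj_left
  · simpa using h.adj_right
  · simp at h2 ⊢; omega

/-- Two triangles joined by a path of length `p` extend to the dumbbell with cycles of odd lengths
`r₁`, `r₂` and a path of length `q`, provided `p = q`, or `2 ≤ p ≤ q` with `p` and `q` of the same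
parity. -/
theorem HasDumbbell.extend [Fintype V] {G : SimpleGraph V} {r₁ r₂ q : ℕ}
    (hr₁ : 3 ≤ r₁) (hr₂ : 3 ≤ r₂) (hodd₁ : Odd r₁) (hodd₂ : Odd r₂)
    (hδ : ∀ v, Fintype.card V ≤ 2 * degIn G univ v + 1)
    (hN : 8 * (r₁ + r₂ + q - 1) ≤ Fintype.card V + 17) {p : ℕ}
    (h : HasDumbbell G 3 3 p) (hp : p = q ∨ (2 ≤ p ∧ p ≤ q ∧ p % 2 = q % 2)) :
    HasDumbbell G r₁ r₂ q := by
  by_contra hfree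
  apply hfree
  have hq : HasDumbbell G 3 3 q := by
    rcases hp with rfl | ⟨hp, hpq, hmod⟩
    · exact h
    · obtain ⟨t, rfl⟩ : ∃ t, q = p + 2 * t := ⟨(q - p) / 2, by omega⟩
      have : ∀ s ≤ t, HasDumbbell G 3 3 (p + 2 * s) := by
        intro s hs
        induction s with
        | zero => simpa using h
        | succ s ih =>
          exact (ih (by omega)).add_two_middle hr₁ hr₂ hfree hδ hN (by omega) (by omega)
      exact this t le_rfl
  have hleft : ∀ t₁, 2 * t₁ + 3 ≤ r₁ → HasDumbbell G (2 * t₁ + 3) 3 q := by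
    intro t ht
    induction t with
    | zero => simpa using hq
    | succ t ih =>
      exact (ih (by omega)).add_two_left hr₁ hr₂ hfree hδ hN (by omega) (by omega)
  have hright : ∀ t₂, 2 * t₂ + 3 ≤ r₂ → HasDumbbell G (2 * t₂ + 3) r₁ q := by
    intro t ht
    induction t with
    | zero =>
      obtain ⟨m, rfl⟩ := hodd₁
      have := hleft (m - 1) (by omega)
      rw [show 2 * (m - 1) + 3 = 2 * m + 1 by omega] at this
      simpa using this.symm
    | succ t ih =>
      exact (ih (by omega)).add_two_left hr₁ hr₂ hfree hδ hN (by omega) (by omega)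
  obtain ⟨m, rfl⟩ := hodd₂
  have := hright (m - 1) (by omega)
  rw [show 2 * (m - 1) + 3 = 2 * m + 1 by omega] at this
  exact this.symm

/-! ### Two disjoint triangles: positive path length -/

/-- Bonferroni's inequality for three neighbourhoods. -/
theorem degIn_add_degIn_add_degIn_le [Fintype V] (G : SimpleGraph V) (a b c : V) :
    degIn G univ a + degIn G univ b + degIn G univ c ≤ Fintype.card V +
      #{v | G.Adj a v ∧ G.Adj b v} + #{v | G.Adj a v ∧ G.Adj c v} +
      #{v | G.Adj b v ∧ G.Adj c v} := by
  unfold degIn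
  rw [← Finset.card_univ, Finset.card_eq_sum_ones univ]
  simp only [Finset.card_filter, ← Finset.sum_add_distrib]
  refine Finset.sum_le_sum fun v _ => ?_
  by_cases h1 : G.Adj a v <;> by_cases h2 : G.Adj b v <;> by_cases h3 : G.Adj c v <;>
    simp [h1, h2, h3]

theorem isNClique_triple {G : SimpleGraph V} {a b c : V} (h1 : G.Adj a b) (h2 : G.Adj b c)
    (h3 : G.Adj a c) : G.IsNClique 3 {a, b, c} :=
  SimpleGraph.is3Clique_triple_iff.2 ⟨h1, h3, h2⟩

theorem exists_third_vertex {G : SimpleGraph V} {T : Finset V} (hT : G.IsNClique 3 T) {x y : V}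
    (hx : x ∈ T) (hy : y ∈ T) (hxy : x ≠ y) :
    ∃ z, T = {x, y, z} ∧ x ≠ z ∧ y ≠ z ∧ G.Adj x y ∧ G.Adj y z ∧ G.Adj x z := by
  have h1 : #((T.erase x).erase y) = 1 := by
    rw [Finset.card_erase_of_mem (Finset.mem_erase.2 ⟨hxy.symm, hy⟩),
      Finset.card_erase_of_mem hx, hT.card_eq]
  obtain ⟨z, hz⟩ := Finset.card_eq_one.1 h1
  have hz' : z ∈ (T.erase x).erase y := by simp [hz]
  simp only [mem_erase] at hz'
  refine ⟨z, ?_, hz'.2.1.symm, hz'.1.symm, hT.isClique hx hy hxy,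
    hT.isClique hy hz'.2.2 hz'.1.symm, hT.isClique hx hz'.2.2 hz'.2.1.symm⟩
  rw [← hz, Finset.insert_erase (Finset.mem_erase.2 ⟨hxy.symm, hy⟩), Finset.insert_erase hx]

theorem exists_other_vertices {G : SimpleGraph V} {T : Finset V} (hT : G.IsNClique 3 T) {x : V}
    (hx : x ∈ T) :
    ∃ y z, T = {x, y, z} ∧ x ≠ y ∧ x ≠ z ∧ y ≠ z ∧ G.Adj x y ∧ G.Adj y z ∧ G.Adj x z := by
  obtain ⟨y, hy, hyx⟩ := Finset.exists_mem_ne (s := T) (by rw [hT.card_eq]; norm_num) x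
  obtain ⟨z, hz⟩ := exists_third_vertex hT hx hy hyx.symm
  exact ⟨y, z, hz.1, hyx.symm, hz.2⟩

/-- Disjoint triangles `S` and `T`, joined by a path with inner vertices `P` outside both, form a
dumbbell. -/
theorem hasDumbbell_of_triangles {G : SimpleGraph V} {S T : Finset V} (hS : G.IsNClique 3 S)
    (hT : G.IsNClique 3 T) (hST : Disjoint S T) {x y : V} (hx : x ∈ S) (hy : y ∈ T)
    {P : List V} (hP : P.Nodup) (hPS : ∀ v ∈ P, v ∉ S ∧ v ∉ T)
    (hch : (x :: (P ++ [y])).IsChain G.Adj) : HasDumbbell G 3 3 (P.length + 1) := by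
  obtain ⟨x', x'', rfl, hx1, hx2, hx3, hxa, hxb, hxc⟩ := exists_other_vertices hS hx
  obtain ⟨y', y'', rfl, hy1, hy2, hy3, hya, hyb, hyc⟩ := exists_other_vertices hT hy
  simp only [Finset.disjoint_left, mem_insert, mem_singleton] at hST hPS
  have hST1 := hST (a := x)
  have hST2 := hST (a := x')
  have hST3 := hST (a := x'')
  have hlast : (x :: (P ++ [y])).getLast? = some y := by
    rw [← List.cons_append, List.getLast?_append]
    rfl
  refine ⟨[x', x''], x :: (P ++ [y]), [y', y''], ⟨?_, ?_, ?_, ?_⟩, rfl, by simp, rfl⟩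
  · simp only [List.nodup_append, List.nodup_cons, List.mem_cons, List.cons_append,
      List.nil_append, List.mem_append]
    grind
  · have h1 : ((x :: (P ++ [y])) ++ [y', y'']).IsChain G.Adj := by
      refine hch.append (by simpa using hyb) ?_
      rw [hlast]
      simpa using hya
    simp only [List.cons_append, List.nil_append, List.isChain_cons_cons] at h1 ⊢
    exact ⟨hxb, hxc.symm, h1⟩
  · simpa using hxa.symm
  · rw [hlast]
    simpa using hyc

/-- Some edge `xy` lies in at least four triangles. Without disjoint triangles, every triangle meets
`{x, y}`, so Mantel's theorem on the remaining vertices makes the degree of `x` or of `y`, say of `z`,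
at least three quarters of the order. A triangle avoiding `z` exists by Mantel's theorem again; the
neighbours of `z` outside it form an independent set, too large for the minimum degree. -/
theorem exists_disjoint_triangles [Fintype V] {G : SimpleGraph V}
    (hδ : ∀ v, Fintype.card V ≤ 2 * degIn G univ v + 1) (hN : 31 ≤ Fintype.card V)
    (hvol : Fintype.card V ^ 2 + 2 * Fintype.card V ≤ 2 * vol G univ) :
    ∃ S T : Finset V, G.IsNClique 3 S ∧ G.IsNClique 3 T ∧ Disjoint S T := by
  by_contra hcon
  push Not at hcon
  obtain ⟨x, y, hxy, hc⟩ : ∃ x y, G.Adj x y ∧ 4 ≤ #{v | G.Adj x v ∧ G.Adj y v} := by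
    obtain ⟨a, -, b, -, c, -, h1, h2, h3⟩ := exists_triangle_of_lt_vol G univ
      (by rw [Finset.card_univ]; omega)
    have := degIn_add_degIn_add_degIn_le G a b c
    have ha := hδ a
    have hb := hδ b
    have hc := hδ c
    by_contra! hno
    have := hno a b h1
    have := hno b c h2
    have := hno a c h3
    omega
  have hmeet : ∀ a b c, G.Adj a b → G.Adj b c → G.Adj a c →
      x ∈ ({a, b, c} : Finset V) ∨ y ∈ ({a, b, c} : Finset V) := by
    intro a b c h1 h2 h3
    by_contra! hno
    obtain ⟨w, hw, hw'⟩ : ∃ w ∈ ({v | G.Adj x v ∧ G.Adj y v} : Finset V),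
        w ∉ ({a, b, c} : Finset V) := by
      apply Finset.exists_mem_notMem_of_card_lt_card
      have := Finset.card_le_three (a := a) (b := b) (c := c)
      omega
    rw [mem_filter] at hw
    refine hcon {a, b, c} {x, y, w} (isNClique_triple h1 h2 h3)
      (isNClique_triple hxy hw.2.2 hw.2.1) ?_
    rw [Finset.disjoint_left]
    simp only [mem_insert, mem_singleton] at *
    grind
  have hdeg : 3 * Fintype.card V ≤ 2 * (degIn G univ x + degIn G univ y) := by
    have hy : y ∈ univ.erase x := by simp [hxy.ne']
    have h1 := two_mul_vol_le_sq G ((univ.erase x).erase y) (by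
      intro a ha b hb c hc h1 h2 h3
      have := hmeet a b c h1 h2 h3
      simp only [mem_erase, mem_univ, and_true, mem_insert, mem_singleton] at ha hb hc this
      grind)
    have h2 := vol_eq_vol_erase_add G (mem_univ x)
    have h3 := vol_eq_vol_erase_add G hy
    have h4 : degIn G (univ.erase x) y + 1 = degIn G univ y := by
      unfold degIn
      rw [Finset.filter_erase, Finset.card_erase_add_one]
      simp [hxy.symm]
    rw [Finset.card_erase_of_mem hy, Finset.card_erase_of_mem (mem_univ x),
      Finset.card_univ] at h1
    obtain ⟨n, hn⟩ : ∃ n, Fintype.card V = n + 2 := ⟨Fintype.card V - 2, by omega⟩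
    rw [hn] at h1 hvol ⊢
    simp only [show n + 2 - 1 - 1 = n by omega] at h1
    nlinarith
  obtain ⟨z, hz⟩ : ∃ z, 3 * Fintype.card V ≤ 4 * degIn G univ z := by
    by_contra! hno
    have := hno x
    have := hno y
    omega
  have hlt : degIn G univ z + 1 ≤ Fintype.card V := by
    rw [degIn_univ]
    exact G.degree_lt_card_verts z
  obtain ⟨a, ha, b, hb, c, hc, h1, h2, h3⟩ := exists_triangle_of_lt_vol G (univ.erase z) (by
    have h2 := vol_eq_vol_erase_add G (mem_univ z)
    rw [Finset.card_erase_of_mem (mem_univ z), Finset.card_univ]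
    obtain ⟨n, hn⟩ : ∃ n, Fintype.card V = n + 1 := ⟨Fintype.card V - 1, by omega⟩
    rw [hn] at hvol hlt ⊢
    simp only [Nat.add_sub_cancel]
    nlinarith)
  obtain ⟨D, hD⟩ : ∃ D : Finset V, D = ({v | G.Adj z v} : Finset V) \ {a, b, c} := ⟨_, rfl⟩
  have hDcard : degIn G univ z ≤ #D + 3 := by
    have := Finset.le_card_sdiff ({a, b, c} : Finset V) ({v | G.Adj z v} : Finset V)
    have h3 := Finset.card_le_three (a := a) (b := b) (c := c)
    rw [← hD] at this
    unfold degIn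
    omega
  obtain ⟨u, hu⟩ := Finset.card_pos.1 (show 0 < #D by omega)
  have huD : degIn G univ u + #D ≤ Fintype.card V := by
    unfold degIn
    rw [← Finset.card_union_of_disjoint]
    · exact Finset.card_le_univ _
    · rw [Finset.disjoint_left]
      intro w hw hw'
      simp only [mem_filter, mem_univ, true_and] at hw
      rw [hD, mem_sdiff, mem_filter] at hu hw'
      refine hcon {a, b, c} {z, u, w} (isNClique_triple h1 h2 h3)
        (isNClique_triple hu.1.2 hw hw'.1.2) ?_
      rw [Finset.disjoint_left]
      simp only [mem_erase, mem_insert, mem_singleton] at *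
      grind
  have := hδ u
  omega

/-- If no edge joins the disjoint triangles `S` and `T`, the six degrees add up to so much that some
other vertex is adjacent to four of the six vertices. -/
theorem exists_vertex_four_neighbors [Fintype V] {G : SimpleGraph V} {S T : Finset V}
    (hS : G.IsNClique 3 S) (hT : G.IsNClique 3 T) (hST : Disjoint S T)
    (hδ : ∀ v, Fintype.card V ≤ 2 * degIn G univ v + 1)
    (hno : ∀ x ∈ S, ∀ y ∈ T, ¬ G.Adj x y) :
    ∃ v, v ∉ S ∧ v ∉ T ∧ 4 ≤ degIn G S v + degIn G T v := by
  by_contra! hcon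
  have hdouble : ∀ W : Finset V, ∑ v, degIn G W v = ∑ w ∈ W, degIn G univ w := by
    intro W
    simp only [degIn, Finset.card_filter]
    rw [Finset.sum_comm]
    simp only [G.adj_comm]
  have hself : ∀ W : Finset V, G.IsNClique 3 W → ∀ v ∈ W, degIn G W v ≤ 2 := by
    intro W hW v hv
    have : #(W.erase v) = 2 := by rw [Finset.card_erase_of_mem hv, hW.card_eq]
    rw [← this]
    refine Finset.card_le_card fun w hw => ?_
    rw [mem_filter] at hw
    exact Finset.mem_erase.2 ⟨hw.2.ne', hw.1⟩
  have hzero : ∀ W W' : Finset V, (∀ x ∈ W, ∀ y ∈ W', ¬ G.Adj x y) → ∀ x ∈ W,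
      degIn G W' x = 0 := by
    intro W W' h x hx
    rw [degIn, Finset.card_eq_zero, Finset.filter_eq_empty_iff]
    exact fun y hy => h x hx y hy
  have hle : ∀ v, degIn G S v + degIn G T v + (if v ∈ S ∪ T then 1 else 0) ≤ 3 := by
    intro v
    by_cases hvS : v ∈ S
    · have := hself S hS v hvS
      have := hzero S T hno v hvS
      simp [hvS]
      omega
    · by_cases hvT : v ∈ T
      · have := hself T hT v hvT
        have := hzero T S (fun x hx y hy h => hno y hy x hx h.symm) v hvT
        simp [hvT]
        omega
      · have := hcon v hvS hvT
        simp [hvT, hvS]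
        omega
  have h1 := Finset.sum_le_sum fun v (_ : v ∈ (univ : Finset V)) => hle v
  rw [Finset.sum_add_distrib, Finset.sum_add_distrib, hdouble, hdouble, Finset.sum_ite_mem,
    Finset.univ_inter, Finset.sum_const, Finset.sum_const, Finset.card_union_of_disjoint hST,
    hS.card_eq, hT.card_eq, Finset.card_univ] at h1
  have hsum : ∀ W : Finset V, #W = 3 →
      3 * Fintype.card V ≤ 2 * (∑ w ∈ W, degIn G univ w) + 3 := by
    intro W hW
    have := Finset.sum_le_sum fun v (_ : v ∈ W) => hδ v
    rw [Finset.sum_const, hW, Finset.sum_add_distrib, ← Finset.mul_sum, Finset.sum_const, hW] at this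
    simpa using this
  have h2 := hsum S hS.card_eq
  have h3 := hsum T hT.card_eq
  simp only [smul_eq_mul] at h1
  omega

/-- As in `exists_vertex_four_neighbors`, with the triangles named so that the vertex `v` is adjacent to
two vertices `x`, `x'` of the first one and to a vertex `y` of the second. -/
theorem exists_vertex_adj_two_of_triangle [Fintype V] {G : SimpleGraph V} {S T : Finset V}
    (hS : G.IsNClique 3 S) (hT : G.IsNClique 3 T) (hST : Disjoint S T)
    (hδ : ∀ v, Fintype.card V ≤ 2 * degIn G univ v + 1)
    (hno : ∀ x ∈ S, ∀ y ∈ T, ¬ G.Adj x y) :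
    ∃ S' T' : Finset V, G.IsNClique 3 S' ∧ G.IsNClique 3 T' ∧ Disjoint S' T' ∧
      ∃ v x y, v ∉ S' ∧ v ∉ T' ∧ y ∈ T' ∧ G.Adj v y ∧ x ∈ S' ∧ G.Adj v x ∧
        ∃ x' ∈ S', x ≠ x' ∧ G.Adj v x' := by
  obtain ⟨v, hvS, hvT, hv⟩ := exists_vertex_four_neighbors hS hT hST hδ hno
  have hle : ∀ W : Finset V, #W = 3 → degIn G W v ≤ 3 := fun W hW => by
    rw [← hW]; exact Finset.card_filter_le _ _
  have hle1 := hle S hS.card_eq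
  have hle2 := hle T hT.card_eq
  have key : ∀ S T : Finset V, G.IsNClique 3 S → G.IsNClique 3 T → Disjoint S T → v ∉ S → v ∉ T →
      1 < degIn G S v → 0 < degIn G T v →
      ∃ S' T' : Finset V, G.IsNClique 3 S' ∧ G.IsNClique 3 T' ∧ Disjoint S' T' ∧
      ∃ v x y, v ∉ S' ∧ v ∉ T' ∧ y ∈ T' ∧ G.Adj v y ∧ x ∈ S' ∧ G.Adj v x ∧
        ∃ x' ∈ S', x ≠ x' ∧ G.Adj v x' := by
    intro S T hS hT hST hvS hvT h1 h2
    obtain ⟨x, hx, x', hx', hne⟩ := Finset.one_lt_card.1 h1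
    obtain ⟨y, hy⟩ := Finset.card_pos.1 h2
    rw [mem_filter] at hx hx' hy
    exact ⟨S, T, hS, hT, hST, v, x, y, hvS, hvT, hy.1, hy.2, hx.1, hx.2, x', hx'.1, hne, hx'.2⟩
  by_cases h : 1 < degIn G S v
  · by_cases h' : 0 < degIn G T v
    · exact key S T hS hT hST hvS hvT h h'
    · omega
  · exact key T S hT hS hST.symm hvT hvS (by omega) (by omega)

theorem disjoint_triple {x y z : V} {T : Finset V} (hx : x ∉ T) (hy : y ∉ T) (hz : z ∉ T) :
    Disjoint ({x, y, z} : Finset V) T := by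
  rw [Finset.disjoint_left]
  simp only [mem_insert, mem_singleton]
  rintro _ (rfl | rfl | rfl) <;> assumption

/-- If no edge joins the two triangles, a vertex adjacent to two vertices of one and to one of the other
takes the place of the third vertex of the former. -/
theorem hasDumbbell_one_of_triangles [Fintype V] {G : SimpleGraph V} {S T : Finset V}
    (hS : G.IsNClique 3 S) (hT : G.IsNClique 3 T) (hST : Disjoint S T)
    (hδ : ∀ v, Fintype.card V ≤ 2 * degIn G univ v + 1) : HasDumbbell G 3 3 1 := by
  by_cases hno : ∀ x ∈ S, ∀ y ∈ T, ¬ G.Adj x y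
  · obtain ⟨S, T, hS, hT, hST, v, x, y, hvS, hvT, hy, hvy, hx, hvx, x', hx', hne, hvx'⟩ :=
      exists_vertex_adj_two_of_triangle hS hT hST hδ hno
    exact hasDumbbell_of_triangles (isNClique_triple hvx (hS.isClique hx hx' hne) hvx') hT
      (disjoint_triple hvT (Finset.disjoint_left.1 hST hx) (Finset.disjoint_left.1 hST hx'))
      (x := v) (by simp) hy (P := []) (by simp) (by simp) (by simpa using hvy)
  · push Not at hno
    obtain ⟨x, hx, y, hy, hxy⟩ := hno
    exact hasDumbbell_of_triangles hS hT hST hx hy (P := []) (by simp) (by simp) (by simpa using hxy)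

/-- If no edge joins the two triangles, some vertex has neighbours in both. If `xy` is an edge between
them, the three vertices `x'`, `x''`, `y'` other than `x`, `y` can have no common neighbours in pairs
outside the triangles, which is too much for their degrees. -/
theorem hasDumbbell_two_of_triangles [Fintype V] {G : SimpleGraph V} {S T : Finset V}
    (hS : G.IsNClique 3 S) (hT : G.IsNClique 3 T) (hST : Disjoint S T)
    (hδ : ∀ v, Fintype.card V ≤ 2 * degIn G univ v + 1) (hN : 31 ≤ Fintype.card V) :
    HasDumbbell G 3 3 2 := by
  by_cases hno : ∀ x ∈ S, ∀ y ∈ T, ¬ G.Adj x y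
  · obtain ⟨S, T, hS, hT, hST, v, x, y, hvS, hvT, hy, hvy, hx, hvx, -⟩ :=
      exists_vertex_adj_two_of_triangle hS hT hST hδ hno
    exact hasDumbbell_of_triangles hS hT hST hx hy (P := [v]) (by simp) (by simp [hvS, hvT])
      (by simp [hvx.symm, hvy])
  · push Not at hno
    obtain ⟨x, hx, y, hy, hxy⟩ := hno
    obtain ⟨x', x'', rfl, hx1, hx2, hx3, hxa, hxb, hxc⟩ := exists_other_vertices hS hx
    obtain ⟨y', y'', rfl, hy1, hy2, hy3, hya, hyb, hyc⟩ := exists_other_vertices hT hy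
    by_contra hcon
    have hST' := Finset.disjoint_left.1 hST
    simp only [mem_insert, mem_singleton] at hST'
    have hcard : ∀ a b : V, a ∈ ({x, x', x''} ∪ {y, y', y''} : Finset V) →
        b ∈ ({x, x', x''} ∪ {y, y', y''} : Finset V) → a ≠ b →
        (∀ v, v ∉ ({x, x', x''} : Finset V) → v ∉ ({y, y', y''} : Finset V) → G.Adj a v →
          G.Adj b v → False) → #{v | G.Adj a v ∧ G.Adj b v} ≤ 4 := by
      intro a b ha hb hab h
      have h6 : #({x, x', x''} ∪ {y, y', y''} : Finset V) = 6 := by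
        rw [Finset.card_union_of_disjoint hST, hS.card_eq, hT.card_eq]
      have h5 : #((({x, x', x''} ∪ {y, y', y''} : Finset V).erase a).erase b) = 4 := by
        rw [Finset.card_erase_of_mem (Finset.mem_erase.2 ⟨hab.symm, hb⟩),
          Finset.card_erase_of_mem ha, h6]
      rw [← h5]
      refine Finset.card_le_card fun v hv => ?_
      rw [mem_filter] at hv
      rw [Finset.mem_erase, Finset.mem_erase, Finset.mem_union]
      refine ⟨hv.2.2.ne', hv.2.1.ne', ?_⟩
      by_contra hv'
      rw [not_or] at hv'
      exact h v hv'.1 hv'.2 hv.2.1 hv.2.2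
    -- a common neighbour of `x'` and `x''` replaces `x` in its triangle, and `x'`, `x`, `y` is the path
    have h1 := hcard x' x'' (by simp) (by simp) hx3 (fun v hvS hvT h1 h2 => hcon
      (hasDumbbell_of_triangles (isNClique_triple h1 h2.symm hxb) hT
        (disjoint_triple (Finset.disjoint_left.1 hST (by simp)) hvT
          (Finset.disjoint_left.1 hST (by simp)))
        (x := x') (by simp) hy (P := [x]) (by simp) (by
          simp only [mem_insert, mem_singleton] at hvS hvT ⊢
          grind) (by simp [hxa.symm, hxy])))
    have h2 := hcard x' y' (by simp) (by simp) (by grind) (fun v hvS hvT h1 h2 => hcon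
      (hasDumbbell_of_triangles hS hT hST (x := x') (y := y') (by simp) (by simp) (P := [v])
        (by simp) (by simp only [List.mem_singleton, forall_eq]; exact ⟨hvS, hvT⟩)
        (by simp [h1, h2.symm])))
    have h3 := hcard x'' y' (by simp) (by simp) (by grind) (fun v hvS hvT h1 h2 => hcon
      (hasDumbbell_of_triangles hS hT hST (x := x'') (y := y') (by simp) (by simp) (P := [v])
        (by simp) (by simp only [List.mem_singleton, forall_eq]; exact ⟨hvS, hvT⟩)
        (by simp [h1, h2.symm])))
    have h4 := degIn_add_degIn_add_degIn_le G x' x'' y'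
    have h5 := hδ x'
    have h6 := hδ x''
    have h7 := hδ y'
    omega

/-- Two vertices of the triangle `S` have a common neighbour outside `S` and `T`. -/
theorem exists_common_neighbor_outside [Fintype V] {G : SimpleGraph V} {S T : Finset V}
    (hS : G.IsNClique 3 S) (hT : G.IsNClique 3 T)
    (hδ : ∀ v, Fintype.card V ≤ 2 * degIn G univ v + 1) (hN : 31 ≤ Fintype.card V) :
    ∃ x ∈ S, ∃ x' ∈ S, ∃ v, x ≠ x' ∧ v ∉ S ∧ v ∉ T ∧ G.Adj x v ∧ G.Adj x' v := by
  obtain ⟨a, b, c, hab, hac, hbc, rfl⟩ := SimpleGraph.is3Clique_iff.1 hS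
  by_contra! hcon
  have hcard : ∀ x ∈ ({a, b, c} : Finset V), ∀ x' ∈ ({a, b, c} : Finset V), x ≠ x' →
      #{v | G.Adj x v ∧ G.Adj x' v} ≤ 4 := by
    intro x hx x' hx' hne
    obtain ⟨z, hz, -⟩ := exists_third_vertex hS hx hx' hne
    have h4 : #(insert z T) ≤ 4 := by
      have := Finset.card_insert_le z T
      rw [hT.card_eq] at this
      exact this
    refine le_trans (Finset.card_le_card fun v hv => ?_) h4
    rw [mem_filter] at hv
    by_contra hv'
    rw [mem_insert, not_or] at hv'
    refine hcon x hx x' hx' v hne ?_ hv'.2 hv.2.1 hv.2.2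
    rw [hz]
    simp [hv.2.1.ne', hv.2.2.ne', hv'.1]
  have h1 := hcard a (by simp) b (by simp) hab.ne
  have h2 := hcard a (by simp) c (by simp) hac.ne
  have h3 := hcard b (by simp) c (by simp) hbc.ne
  have h4 := degIn_add_degIn_add_degIn_le G a b c
  have h5 := hδ a
  have h6 := hδ b
  have h7 := hδ c
  omega

/-- Let `v` be a common neighbour of two vertices `x`, `x'` of `S` and `y` a vertex of `T`. A path of
length three from `v` to `y` joins the triangle `v`, `x`, `x'` to `T`; a path of length two from `v`
to `y` starts, after adding `x`, in `S`. -/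
theorem hasDumbbell_three_of_triangles [Fintype V] {G : SimpleGraph V} {r₁ r₂ q : ℕ}
    (hr₁ : 3 ≤ r₁) (hr₂ : 3 ≤ r₂) (hq : 3 ≤ q) (hfree : ¬ HasDumbbell G r₁ r₂ q)
    (hδ : ∀ v, Fintype.card V ≤ 2 * degIn G univ v + 1)
    (hN : 8 * (r₁ + r₂ + q - 1) ≤ Fintype.card V + 17) {S T : Finset V}
    (hS : G.IsNClique 3 S) (hT : G.IsNClique 3 T) (hST : Disjoint S T) :
    HasDumbbell G 3 3 3 := by
  obtain ⟨x, hx, x', hx', v, hne, hvS, hvT, hxv, hx'v⟩ :=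
    exists_common_neighbor_outside hS hT hδ (by omega)
  obtain ⟨x'', rfl, hx1, hx2, hx3, hx4, hx5⟩ := exists_third_vertex hS hx hx' hne
  obtain ⟨y, hy⟩ : T.Nonempty := by
    rw [← Finset.card_pos, hT.card_eq]; norm_num
  have hR : G.IsNClique 3 {v, x, x'} := isNClique_triple hxv.symm hx3 hx'v.symm
  have hRT : Disjoint ({v, x, x'} : Finset V) T :=
    disjoint_triple hvT (Finset.disjoint_left.1 hST hx) (Finset.disjoint_left.1 hST hx')
  have hcard : #({v, x, x'} ∪ T : Finset V) = 6 := by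
    rw [Finset.card_union_of_disjoint hRT, hR.card_eq, hT.card_eq]
  rcases exists_path_three_or_common hr₁ hr₂ hfree hδ hN (S := {v, x, x'} ∪ T) (x := v) (y := y)
    (by omega) (by simp) (by simp [hy]) with ⟨a, b, ha, hb, hva, hab, hby⟩ | h
  · rw [Finset.mem_union, not_or] at ha hb
    exact hasDumbbell_of_triangles hR hT hRT (x := v) (y := y) (by simp) hy (P := [a, b])
      (by simpa using hab.ne) (by
        simp only [List.mem_cons, List.not_mem_nil, or_false]
        rintro w (rfl | rfl)
        exacts [ha, hb]) (by simp [hva, hab, hby])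
  -- only `x''` is a possible bad choice for the middle vertex, and there are two choices
  · obtain ⟨z, hz, hzx⟩ := Finset.exists_mem_ne (lt_of_lt_of_le one_lt_two h) x''
    rw [mem_filter, mem_compl, mem_union, not_or] at hz
    refine hasDumbbell_of_triangles hS hT hST hx hy (P := [v, z]) (by simpa using hz.2.1.ne) ?_
      (by simp [hxv, hz.2.1, hz.2.2.symm])
    simp only [List.mem_cons, List.not_mem_nil, or_false]
    rintro w (rfl | rfl)
    · exact ⟨hvS, hvT⟩
    · refine ⟨?_, hz.1.2⟩
      have := hz.1.1
      simp only [mem_insert, mem_singleton] at this ⊢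
      tauto

theorem hasDumbbell_of_vol_of_pos [Fintype V] {G : SimpleGraph V} {r₁ r₂ q : ℕ}
    (hr₁ : 3 ≤ r₁) (hr₂ : 3 ≤ r₂) (hodd₁ : Odd r₁) (hodd₂ : Odd r₂) (hq : 1 ≤ q)
    (hδ : ∀ v, Fintype.card V ≤ 2 * degIn G univ v + 1)
    (hN : 8 * (r₁ + r₂ + q - 1) ≤ Fintype.card V + 17)
    (hvol : Fintype.card V ^ 2 + 2 * Fintype.card V ≤ 2 * vol G univ) :
    HasDumbbell G r₁ r₂ q := by
  have h31 : 31 ≤ Fintype.card V := by omega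
  obtain ⟨S, T, hS, hT, hST⟩ := exists_disjoint_triangles hδ h31 hvol
  rcases Nat.even_or_odd' q with ⟨t, rfl | rfl⟩
  · exact (hasDumbbell_two_of_triangles hS hT hST hδ h31).extend hr₁ hr₂ hodd₁ hodd₂ hδ hN
      (.inr (by omega))
  · by_cases ht : t = 0
    · exact (hasDumbbell_one_of_triangles hS hT hST hδ).extend hr₁ hr₂ hodd₁ hodd₂ hδ hN
        (.inl (by omega))
    · by_contra hfree
      exact hfree ((hasDumbbell_three_of_triangles hr₁ hr₂ (by omega) hfree hδ hN hS hT
        hST).extend hr₁ hr₂ hodd₁ hodd₂ hδ hN (.inr (by omega)))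

/-! ### Bowties: path length zero -/

theorem hasDumbbell_three_three_zero {G : SimpleGraph V} {x a b c d : V}
    (hxa : G.Adj x a) (hxb : G.Adj x b) (hab : G.Adj a b) (hxc : G.Adj x c) (hxd : G.Adj x d)
    (hcd : G.Adj c d) (hac : a ≠ c) (had : a ≠ d) (hbc : b ≠ c) (hbd : b ≠ d) :
    HasDumbbell G 3 3 0 := by
  have h1 := hxa.ne
  have h2 := hxb.ne
  have h3 := hxc.ne
  have h4 := hxd.ne
  have h5 := hab.ne
  have h6 := hcd.ne
  refine ⟨[a, b], [x], [c, d], ⟨?_, ?_, ?_, ?_⟩, rfl, rfl, rfl⟩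
  · simp only [List.cons_append, List.nil_append, List.nodup_cons, List.mem_cons]
    grind
  · simp [hab, hxb.symm, hxc, hcd]
  · simpa using hxa.symm
  · simpa using hxd

/-- `xy` is the spine of a large book: every edge inside `N(x)` contains `y`, every edge inside `N(y)`
contains `x`, and `x`, `y` have about half of all vertices as common neighbours. -/
structure IsBook [Fintype V] (G : SimpleGraph V) (x y : V) : Prop where
  adj : G.Adj x y
  left : ∀ u v, G.Adj x u → G.Adj x v → G.Adj u v → u = y ∨ v = y
  right : ∀ u v, G.Adj y u → G.Adj y v → G.Adj u v → u = x ∨ v = x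
  card_le : Fintype.card V ≤ 2 * #{v | G.Adj x v ∧ G.Adj y v} + 7

/-- By Bonferroni's inequality two vertices `x`, `y` of the triangle have at least four common neighbours.
An edge inside `N(x)` that misses `y` would then form a bowtie with one of the triangles on `xy`.
Hence a common neighbour `w` shares only `y` with `N(x)` and only `x` with `N(y)`, and Bonferroni's
inequality for `x`, `y`, `w` makes the book large. -/
theorem exists_isBook_of_triangle [Fintype V] {G : SimpleGraph V}
    (hfree : ¬ HasDumbbell G 3 3 0) (hδ : ∀ v, Fintype.card V ≤ 2 * degIn G univ v + 1)
    (hN : 23 ≤ Fintype.card V) {T : Finset V} (hT : G.IsNClique 3 T) :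
    ∃ x ∈ T, ∃ y ∈ T, IsBook G x y := by
  obtain ⟨x, hx, y, hy, hxy, hc⟩ : ∃ x ∈ T, ∃ y ∈ T, G.Adj x y ∧
      4 ≤ #{v | G.Adj x v ∧ G.Adj y v} := by
    obtain ⟨a, b, c, hab, hac, hbc, rfl⟩ := SimpleGraph.is3Clique_iff.1 hT
    by_contra! hcon
    have h1 := hcon a (by simp) b (by simp) hab
    have h2 := hcon a (by simp) c (by simp) hac
    have h3 := hcon b (by simp) c (by simp) hbc
    have h4 := degIn_add_degIn_add_degIn_le G a b c
    have h5 := hδ a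
    have h6 := hδ b
    have h7 := hδ c
    omega
  have key : ∀ x y, G.Adj x y → 4 ≤ #{v | G.Adj x v ∧ G.Adj y v} →
      ∀ u v, G.Adj x u → G.Adj x v → G.Adj u v → u = y ∨ v = y := by
    intro x y hxy hc u v hxu hxv huv
    by_contra! hne
    obtain ⟨w, hw, hw'⟩ : ∃ w ∈ ({v | G.Adj x v ∧ G.Adj y v} : Finset V),
        w ∉ ({u, v} : Finset V) := by
      apply Finset.exists_mem_notMem_of_card_lt_card
      have := Finset.card_le_two (a := u) (b := v)
      omega
    rw [mem_filter] at hw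
    simp only [mem_insert, mem_singleton, not_or] at hw'
    exact hfree (hasDumbbell_three_three_zero hxu hxv huv hxy hw.2.1 hw.2.2 hne.1 (Ne.symm hw'.1)
      hne.2 (Ne.symm hw'.2))
  have hl := key x y hxy hc
  have hr := key y x hxy.symm (by simpa only [and_comm] using hc)
  refine ⟨x, hx, y, hy, hxy, hl, hr, ?_⟩
  obtain ⟨w, hw⟩ := Finset.card_pos.1 (lt_of_lt_of_le (by norm_num) hc)
  rw [mem_filter] at hw
  have h1 : #{v | G.Adj x v ∧ G.Adj w v} ≤ 1 := by
    rw [← Finset.card_singleton y]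
    refine Finset.card_le_card fun v hv => ?_
    rw [mem_filter] at hv
    rw [mem_singleton]
    exact (hl w v hw.2.1 hv.2.1 hv.2.2).resolve_left hw.2.2.ne'
  have h2 : #{v | G.Adj y v ∧ G.Adj w v} ≤ 1 := by
    rw [← Finset.card_singleton x]
    refine Finset.card_le_card fun v hv => ?_
    rw [mem_filter] at hv
    rw [mem_singleton]
    exact (hr w v hw.2.2 hv.2.1 hv.2.2).resolve_left hw.2.1.ne'
  have h3 := degIn_add_degIn_add_degIn_le G x y w
  have h4 := hδ x
  have h5 := hδ y
  have h6 := hδ w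
  omega

/-- A triangle contains both ends of the spine of a book or neither. -/
theorem IsBook.mem_iff [Fintype V] {G : SimpleGraph V} {x y : V} (h : IsBook G x y)
    {T : Finset V} (hT : G.IsNClique 3 T) : x ∈ T ↔ y ∈ T := by
  constructor
  · intro hx
    obtain ⟨u, v, rfl, -, -, -, hxu, huv, hxv⟩ := exists_other_vertices hT hx
    have := h.left u v hxu hxv huv
    simp only [mem_insert, mem_singleton]
    grind
  · intro hy
    obtain ⟨u, v, rfl, -, -, -, hyu, huv, hyv⟩ := exists_other_vertices hT hy
    have := h.right u v hyu hyv huv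
    simp only [mem_insert, mem_singleton]
    grind

/-- The vertices of the book with spine `xy`: the two ends of the spine and their common neighbours. -/
noncomputable def bookSet [Fintype V] (G : SimpleGraph V) (x y : V) : Finset V :=
  insert x (insert y ({v | G.Adj x v ∧ G.Adj y v} : Finset V))

theorem IsBook.card_bookSet [Fintype V] {G : SimpleGraph V} {x y : V} (h : IsBook G x y) :
    Fintype.card V ≤ 2 * #(bookSet G x y) + 3 := by
  rw [bookSet, Finset.card_insert_of_notMem, Finset.card_insert_of_notMem]
  · have := h.card_le
    omega
  · simp
  · simp [h.adj.ne]

theorem IsBook.disjoint_bookSet [Fintype V] {G : SimpleGraph V} (hfree : ¬ HasDumbbell G 3 3 0)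
    {x y x' y' : V} (h : IsBook G x y) (h' : IsBook G x' y') (hxx : x ≠ x') (hxy : x ≠ y')
    (hyx : y ≠ x') (hyy : y ≠ y') : Disjoint (bookSet G x y) (bookSet G x' y') := by
  have key : ∀ {x y x' y' : V}, IsBook G x y → IsBook G x' y' → x ≠ x' → x ≠ y' → y ≠ x' →
      y ≠ y' → ∀ w, G.Adj x w → G.Adj y w → w ≠ x' ∧ w ≠ y' := by
    intro x y x' y' h h' hxx hxy hyx hyy w hxw hyw
    have h1 := h'.mem_iff (isNClique_triple h.adj hyw hxw)
    have h2 := h'.adj.ne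
    simp only [mem_insert, mem_singleton] at h1
    grind
  have k1 := key h h' hxx hxy hyx hyy
  have k2 := key h' h hxx.symm hyx.symm hxy.symm hyy.symm
  rw [Finset.disjoint_left]
  intro w hw hw'
  simp only [bookSet, mem_insert, mem_filter, mem_univ, true_and] at hw hw'
  rcases hw with rfl | rfl | hw
  · rcases hw' with rfl | rfl | hw'
    · exact hxx rfl
    · exact hxy rfl
    · exact (k2 _ hw'.1 hw'.2).1 rfl
  · rcases hw' with rfl | rfl | hw'
    · exact hyx rfl
    · exact hyy rfl
    · exact (k2 _ hw'.1 hw'.2).2 rfl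
  · rcases hw' with rfl | rfl | hw'
    · exact (k1 _ hw.1 hw.2).1 rfl
    · exact (k1 _ hw.1 hw.2).2 rfl
    · exact hfree (hasDumbbell_three_three_zero hw.1.symm hw.2.symm h.adj hw'.1.symm hw'.2.symm
        h'.adj hxx hxy hyx hyy)

/-- Let `w` be a page of the first of two disjoint books. Then `w` is not adjacent to the spine `x₂y₂` of
the second, since `w` has a neighbour among its pages; and `x₁` is not adjacent to both `x₂` and `y₂`.
So `N(x₁)` and `N(w)`, which share only `y₁`, do not cover all vertices. -/
theorem IsBook.degIn_add_degIn_le [Fintype V] {G : SimpleGraph V}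
    (hδ : ∀ v, Fintype.card V ≤ 2 * degIn G univ v + 1) (hN : 23 ≤ Fintype.card V)
    {x₁ y₁ x₂ y₂ w : V} (hb₁ : IsBook G x₁ y₁) (hb₂ : IsBook G x₂ y₂)
    (hd₁₂ : Disjoint (bookSet G x₁ y₁) (bookSet G x₂ y₂)) (hw : G.Adj x₁ w ∧ G.Adj y₁ w) :
    degIn G univ x₁ + degIn G univ w ≤ Fintype.card V := by
  have hdis := Finset.disjoint_left.1 hd₁₂
  have hwb : w ∈ bookSet G x₁ y₁ := by simp [bookSet, hw]
  -- a neighbour of `w` among the pages of the second book, as the two page sets cover almost everything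
  obtain ⟨w', hw', hww'⟩ : ∃ w', (G.Adj x₂ w' ∧ G.Adj y₂ w') ∧ G.Adj w w' := by
    by_contra! hno
    have h1 : Disjoint ({v | G.Adj w v} : Finset V)
        (({v | G.Adj x₁ v ∧ G.Adj y₁ v} : Finset V) ∪
          ({v | G.Adj x₂ v ∧ G.Adj y₂ v} : Finset V)) := by
      rw [Finset.disjoint_left]
      intro v hv hv'
      simp only [mem_union, mem_filter, mem_univ, true_and] at hv hv'
      rcases hv' with hv' | hv'
      · rcases hb₁.left w v hw.1 hv'.1 hv with rfl | rfl
        · exact hw.2.ne rfl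
        · exact hv'.2.ne rfl
      · exact hno v hv' hv
    have h2 : Disjoint ({v | G.Adj x₁ v ∧ G.Adj y₁ v} : Finset V)
        ({v | G.Adj x₂ v ∧ G.Adj y₂ v} : Finset V) := by
      refine hd₁₂.mono ?_ ?_ <;>
      exact (Finset.subset_insert _ _).trans (Finset.subset_insert _ _)
    have h3 := Finset.card_le_univ (({v | G.Adj w v} : Finset V) ∪
      (({v | G.Adj x₁ v ∧ G.Adj y₁ v} : Finset V) ∪ ({v | G.Adj x₂ v ∧ G.Adj y₂ v} : Finset V)))
    rw [Finset.card_union_of_disjoint h1, Finset.card_union_of_disjoint h2] at h3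
    have h4 := hb₁.card_le
    have h5 := hb₂.card_le
    have h6 := hδ w
    unfold degIn at h6
    omega
  have hwx₂ : ¬ G.Adj w x₂ := by
    intro h
    rcases hb₂.left w w' h.symm hw'.1 hww' with rfl | rfl
    · exact hdis hwb (by simp [bookSet])
    · exact hw'.2.ne rfl
  have hwy₂ : ¬ G.Adj w y₂ := by
    intro h
    rcases hb₂.right w w' h.symm hw'.2 hww' with rfl | rfl
    · exact hdis hwb (by simp [bookSet])
    · exact hw'.1.ne rfl
  have hx₁b : x₁ ∈ bookSet G x₁ y₁ := by simp [bookSet]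
  obtain ⟨s, hs₁, hs₂⟩ : ∃ s, ¬ G.Adj x₁ s ∧ ¬ G.Adj w s := by
    by_cases h : G.Adj x₁ x₂
    · refine ⟨y₂, fun h' => ?_, hwy₂⟩
      exact hdis hx₁b (by simp [bookSet, h.symm, h'.symm])
    · exact ⟨x₂, h, hwx₂⟩
  unfold degIn
  rw [← Finset.card_union_add_card_inter]
  have h1 : #(({v | G.Adj x₁ v} : Finset V) ∪ ({v | G.Adj w v} : Finset V)) <
      Fintype.card V := by
    rw [Finset.card_lt_iff_ne_univ]
    intro h
    have := Finset.mem_univ s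
    rw [← h] at this
    simp [hs₁, hs₂] at this
  have h2 : #(({v | G.Adj x₁ v} : Finset V) ∩ ({v | G.Adj w v} : Finset V)) ≤ 1 := by
    rw [← Finset.card_singleton y₁]
    refine Finset.card_le_card fun v hv => ?_
    simp only [mem_inter, mem_filter, mem_univ, true_and] at hv
    rw [mem_singleton]
    exact (hb₁.left w v hw.1 hv.1 hv.2).resolve_left hw.2.ne'
  omega

/-- Two edges above the Turán number force a bowtie. Otherwise there is one book, and a second one after
deleting its spine. Deleting the end `x₁` of the first spine and one of its pages `w`, which have
degree sum at most the order, leaves a graph that is still two edges above its Mantel bound, hence has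
a triangle avoiding the second spine. This gives a third book, and three disjoint books do not fit. -/
theorem hasDumbbell_three_three_zero_of_vol [Fintype V] {G : SimpleGraph V}
    (hδ : ∀ v, Fintype.card V ≤ 2 * degIn G univ v + 1) (hN : 23 ≤ Fintype.card V)
    (hvol : Fintype.card V ^ 2 + 7 ≤ 2 * vol G univ) : HasDumbbell G 3 3 0 := by
  by_contra hfree
  obtain ⟨a, -, b, -, c, -, h1, h2, h3⟩ := exists_triangle_of_lt_vol G univ
    (by rw [Finset.card_univ]; omega)
  obtain ⟨x₁, -, y₁, -, hb₁⟩ := exists_isBook_of_triangle hfree hδ hN (isNClique_triple h1 h2 h3)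
  obtain ⟨a, -, b, -, c, -, ⟨h1, h2, h3⟩, hnot⟩ := exists_triangle_avoiding_edge G univ hb₁.adj.ne
    (by rw [Finset.card_univ]; omega)
  have hT := isNClique_triple h1 h2 h3
  have hx₁T : x₁ ∉ ({a, b, c} : Finset V) := fun h => hnot ⟨h, (hb₁.mem_iff hT).1 h⟩
  have hy₁T : y₁ ∉ ({a, b, c} : Finset V) := fun h => hnot ⟨(hb₁.mem_iff hT).2 h, h⟩
  obtain ⟨x₂, hx₂, y₂, hy₂, hb₂⟩ := exists_isBook_of_triangle hfree hδ hN hT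
  have hd₁₂ := hb₁.disjoint_bookSet hfree hb₂ (ne_of_mem_of_not_mem hx₂ hx₁T).symm
    (ne_of_mem_of_not_mem hy₂ hx₁T).symm (ne_of_mem_of_not_mem hx₂ hy₁T).symm
    (ne_of_mem_of_not_mem hy₂ hy₁T).symm
  obtain ⟨w, hw⟩ : ({v | G.Adj x₁ v ∧ G.Adj y₁ v} : Finset V).Nonempty := by
    rw [← Finset.card_pos]
    have := hb₁.card_le
    omega
  simp only [mem_filter, mem_univ, true_and] at hw
  have hdeg := hb₁.degIn_add_degIn_le hδ hN hb₂ hd₁₂ hw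
  obtain ⟨a, ha, b, hb, c, hc, ⟨h1, h2, h3⟩, hnot'⟩ := exists_triangle_avoiding_edge G
    ((univ.erase x₁).erase w) hb₂.adj.ne (by
      have hw0 : w ∈ univ.erase x₁ := by simp [hw.1.ne']
      have h2 := vol_eq_vol_erase_add G (mem_univ x₁)
      have h3 := vol_eq_vol_erase_add G hw0
      have h4 : degIn G (univ.erase x₁) w + 1 = degIn G univ w := by
        unfold degIn
        rw [Finset.filter_erase, Finset.card_erase_add_one]
        simp [hw.1.symm]
      rw [Finset.card_erase_of_mem hw0, Finset.card_erase_of_mem (mem_univ x₁), Finset.card_univ]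
      obtain ⟨n, hn⟩ : ∃ n, Fintype.card V = n + 2 := ⟨Fintype.card V - 2, by omega⟩
      rw [hn] at hvol hdeg ⊢
      simp only [show n + 2 - 1 - 1 = n by omega]
      nlinarith)
  have hT' := isNClique_triple h1 h2 h3
  have hx₁ : x₁ ∉ ({a, b, c} : Finset V) := by
    simp only [mem_erase, mem_univ, and_true, mem_insert, mem_singleton] at ha hb hc ⊢
    grind
  have hy₁ : y₁ ∉ ({a, b, c} : Finset V) := fun h => hx₁ ((hb₁.mem_iff hT').2 h)
  have hx₂T : x₂ ∉ ({a, b, c} : Finset V) := fun h => hnot' ⟨h, (hb₂.mem_iff hT').1 h⟩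
  have hy₂T : y₂ ∉ ({a, b, c} : Finset V) := fun h => hnot' ⟨(hb₂.mem_iff hT').2 h, h⟩
  obtain ⟨x₃, hx₃, y₃, hy₃, hb₃⟩ := exists_isBook_of_triangle hfree hδ hN hT'
  have hd₁₃ := hb₁.disjoint_bookSet hfree hb₃ (ne_of_mem_of_not_mem hx₃ hx₁).symm
    (ne_of_mem_of_not_mem hy₃ hx₁).symm (ne_of_mem_of_not_mem hx₃ hy₁).symm
    (ne_of_mem_of_not_mem hy₃ hy₁).symm
  have hd₂₃ := hb₂.disjoint_bookSet hfree hb₃ (ne_of_mem_of_not_mem hx₃ hx₂T).symm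
    (ne_of_mem_of_not_mem hy₃ hx₂T).symm (ne_of_mem_of_not_mem hx₃ hy₂T).symm
    (ne_of_mem_of_not_mem hy₃ hy₂T).symm
  have hle := Finset.card_le_univ (bookSet G x₁ y₁ ∪ bookSet G x₂ y₂ ∪ bookSet G x₃ y₃)
  rw [Finset.card_union_of_disjoint (Finset.disjoint_union_left.2 ⟨hd₁₃, hd₂₃⟩),
    Finset.card_union_of_disjoint hd₁₂] at hle
  have := hb₁.card_bookSet
  have := hb₂.card_bookSet
  have := hb₃.card_bookSet
  omega

/-! ### Reduction to large minimum degree -/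

/-- Deleting vertices of small degree. Here `g` is an edge count that grows by at least `⌊N / 2⌋` from
`N - 1` to `N` vertices, and `h` is the order of the dumbbell. Either the deletion stops at a set `U`
of at least `8 * h - 17` vertices that still has `g #U` edges, with minimum degree about half of `#U`,
or it goes further down and, thanks to the edges gained on the way, stops at a nonempty set with
minimum degree at least `(#U + h - 2) / 2`. -/
theorem exists_dense_subset [Fintype V] (G : SimpleGraph V) {h : ℕ} (hh : 5 ≤ h) (g : ℕ → ℕ)
    (hg : ∀ N, g N + (N + 1) / 2 ≤ g (N + 1)) (hg' : ∀ N, 3 ≤ N → N ^ 2 / 4 + 2 ≤ g N)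
    (hn : (2 * h - 3) ^ 2 + (2 * h - 3) ≤ Fintype.card V)
    (hvol : 2 * g (Fintype.card V) ≤ vol G univ) :
    ∃ U : Finset V, (8 * h ≤ #U + 17 ∧ 2 * g #U ≤ vol G U ∧ ∀ v ∈ U, #U ≤ 2 * degIn G U v + 1) ∨
      (U.Nonempty ∧ ∀ v ∈ U, #U + h ≤ 2 * degIn G U v + 2) := by
  obtain ⟨j, rfl⟩ : ∃ j, h = j + 5 := ⟨h - 5, by omega⟩
  obtain ⟨n, hcard⟩ : ∃ n, Fintype.card V = n := ⟨_, rfl⟩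
  rw [hcard] at hn hvol
  have hn' : 4 * j ^ 2 + 30 * j + 56 ≤ n := by
    refine le_trans (le_of_eq ?_) hn
    rw [show 2 * (j + 5) - 3 = 2 * j + 7 by omega]
    ring
  -- Down to `8 * h - 17 = 8 * j + 23` vertices each deletion gains an edge on `g`. Below that, the bound
  -- on `4 * e(U)` grows by `2 * N + 2 * (h - 3)` at `N`, which is what the denser degree condition
  -- costs, and it is positive at `N = 0`, which excludes the empty set.
  obtain ⟨U, hU, hmin⟩ := exists_minimal_finset G (fun N t =>
    if 8 * j + 23 ≤ N then 2 * (g N + n) ≤ t + 2 * N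
    else N ^ 2 + N + 2 * N * (j + 2) + 1 ≤ 2 * t) (by
      rw [Finset.card_univ, hcard]
      rw [if_pos (by nlinarith)]
      omega)
  refine ⟨U, ?_⟩
  have hle : #U ≤ n := hcard ▸ Finset.card_le_univ U
  by_cases hbig : 8 * j + 23 ≤ #U
  · left
    rw [if_pos hbig] at hU
    refine ⟨by omega, by omega, fun v hv => ?_⟩
    have h1 := hmin v hv
    have h2 := vol_eq_vol_erase_add G hv
    have h3 := Finset.card_erase_add_one hv
    by_cases hbig' : 8 * j + 23 ≤ #(U.erase v)
    · rw [if_pos hbig'] at h1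
      have := hg #(U.erase v)
      rw [h3] at this
      omega
    -- where the two bounds meet: the surplus accumulated so far exceeds the second bound
    · rw [if_neg hbig'] at h1
      have h4 : #(U.erase v) = 8 * j + 22 := by omega
      have h5 : #U = 8 * j + 23 := by omega
      have h6 := hg' #U (by omega)
      rw [h5] at h6 hU ⊢
      rw [h4] at h1
      have h7 : (8 * j + 23) ^ 2 / 4 = 16 * j ^ 2 + 92 * j + 132 := by
        rw [show (8 * j + 23) ^ 2 = 1 + 4 * (16 * j ^ 2 + 92 * j + 132) by ring]
        omega
      rw [h7] at h6
      have h8 : (8 * j + 22) ^ 2 + (8 * j + 22) + 2 * (8 * j + 22) * (j + 2) + 1 =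
        80 * j ^ 2 + 436 * j + 595 := by ring
      rw [h8] at h1
      omega
  · right
    rw [if_neg hbig] at hU
    refine ⟨?_, fun v hv => ?_⟩
    · rw [Finset.nonempty_iff_ne_empty]
      rintro rfl
      simp [vol] at hU
    · have h1 := hmin v hv
      have h2 := vol_eq_vol_erase_add G hv
      have h3 := Finset.card_erase_add_one hv
      rw [if_neg (by omega)] at h1
      rw [← h3] at hU ⊢
      nlinarith

/-- Reduction to induced subgraphs with a minimum degree of about half their order, which are assumed to
contain the dumbbell in `hstab`. -/
theorem isContained_of_vol [Fintype V] {G : SimpleGraph V} {r₁ r₂ q : ℕ} (hr₁ : 3 ≤ r₁)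
    (hr₂ : 3 ≤ r₂) (g : ℕ → ℕ) (hg : ∀ N, g N + (N + 1) / 2 ≤ g (N + 1))
    (hg' : ∀ N, 3 ≤ N → N ^ 2 / 4 + 2 ≤ g N)
    (hn : (2 * (r₁ + r₂ + q - 1) - 3) ^ 2 + (2 * (r₁ + r₂ + q - 1) - 3) ≤ Fintype.card V)
    (hvol : 2 * g (Fintype.card V) ≤ vol G univ)
    (hstab : ∀ U : Finset V, 8 * (r₁ + r₂ + q - 1) ≤ #U + 17 →
      (∀ v : (U : Set V), #U ≤ 2 * degIn (G.induce (U : Set V)) univ v + 1) →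
      2 * g #U ≤ vol (G.induce (U : Set V)) univ →
      HasDumbbell (G.induce (U : Set V)) r₁ r₂ q) :
    SimpleGraph.IsContained (dumbbell r₁ r₂ q) G := by
  obtain ⟨U, ⟨h1, h2, h3⟩ | ⟨h1, h2⟩⟩ := exists_dense_subset G (by omega) g hg hg' hn hvol
  · refine ((hstab U h1 ?_ ?_).isContained (by omega) (by omega)).trans
      ⟨SimpleGraph.Copy.induce G _⟩
    · intro v
      rw [degIn_induce]
      exact h3 v v.2
    · rwa [vol_induce]
  · exact (hasDumbbell_of_dense h1 hr₁ hr₂ h2).isContained (by omega) (by omega)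

theorem sq_div_four_succ (N : ℕ) : (N + 1) ^ 2 / 4 = N ^ 2 / 4 + (N + 1) / 2 := by
  rcases Nat.even_or_odd' N with ⟨m, rfl | rfl⟩
  · rw [show (2 * m + 1) ^ 2 = 1 + 4 * (m ^ 2 + m) by ring, show (2 * m) ^ 2 = 4 * m ^ 2 by ring]
    omega
  · rw [show (2 * m + 1) ^ 2 = 1 + 4 * (m ^ 2 + m) by ring,
      show (2 * m + 1 + 1) ^ 2 = 4 * (m ^ 2 + 2 * m + 1) by ring]
    omega

theorem sq_le_four_mul_div (N : ℕ) : N ^ 2 ≤ 4 * (N ^ 2 / 4) + N % 2 := by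
  rcases Nat.even_or_odd' N with ⟨m, rfl | rfl⟩
  · rw [show (2 * m) ^ 2 = 4 * m ^ 2 by ring]
    omega
  · rw [show (2 * m + 1) ^ 2 = 1 + 4 * (m ^ 2 + m) by ring]
    omega

theorem isContained_of_card_edgeFinset_zero [Fintype V] {G : SimpleGraph V} {r₁ r₂ : ℕ}
    (hr₁ : 3 ≤ r₁) (hr₂ : 3 ≤ r₂) (hodd₁ : Odd r₁) (hodd₂ : Odd r₂)
    (hn : (2 * (r₁ + r₂ + 0 - 1) - 3) ^ 2 + (2 * (r₁ + r₂ + 0 - 1) - 3) ≤ Fintype.card V)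
    (hE : Fintype.card V ^ 2 / 4 + 2 ≤ #G.edgeFinset) :
    SimpleGraph.IsContained (dumbbell r₁ r₂ 0) G := by
  refine isContained_of_vol hr₁ hr₂ (fun N => N ^ 2 / 4 + 2) ?_ (fun _ _ => le_rfl) hn ?_ ?_
  · intro N
    have := sq_div_four_succ N
    omega
  · rw [vol_univ]
    omega
  · intro U hU hδ hvol
    have hc : Fintype.card (U : Set V) = #U := by simp
    rw [← hc] at hU hδ hvol
    refine (hasDumbbell_three_three_zero_of_vol hδ (by omega) ?_).extend hr₁ hr₂ hodd₁ hodd₂ hδ hU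
      (.inl rfl)
    have := sq_le_four_mul_div (Fintype.card (U : Set V))
    omega

theorem isContained_of_card_edgeFinset_pos [Fintype V] {G : SimpleGraph V} {r₁ r₂ q : ℕ}
    (hr₁ : 3 ≤ r₁) (hr₂ : 3 ≤ r₂) (hodd₁ : Odd r₁) (hodd₂ : Odd r₂) (hq : 1 ≤ q)
    (hn : (2 * (r₁ + r₂ + q - 1) - 3) ^ 2 + (2 * (r₁ + r₂ + q - 1) - 3) ≤ Fintype.card V)
    (hE : Fintype.card V ^ 2 / 4 + (Fintype.card V + 1) / 2 ≤ #G.edgeFinset) :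
    SimpleGraph.IsContained (dumbbell r₁ r₂ q) G := by
  refine isContained_of_vol hr₁ hr₂ (fun N => N ^ 2 / 4 + (N + 1) / 2) ?_ ?_ hn ?_ ?_
  · intro N
    have := sq_div_four_succ N
    omega
  · intro N hN
    omega
  · rw [vol_univ]
    omega
  · intro U hU hδ hvol
    have hc : Fintype.card (U : Set V) = #U := by simp
    rw [← hc] at hU hδ hvol
    refine hasDumbbell_of_vol_of_pos hr₁ hr₂ hodd₁ hodd₂ hq hδ hU ?_
    have := sq_le_four_mul_div (Fintype.card (U : Set V))
    omega

/-! ### The extremal graphs -/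

theorem card_edgeFinset_turanGraph_two (n : ℕ) :
    #(SimpleGraph.turanGraph n 2).edgeFinset = n ^ 2 / 4 := by
  rw [SimpleGraph.card_edgeFinset_turanGraph]
  rcases Nat.even_or_odd' n with ⟨m, rfl | rfl⟩
  · simp
  · rw [show (2 * m + 1) ^ 2 = 1 + 4 * (m ^ 2 + m) by ring, show (2 * m + 1) % 2 = 1 by omega]
    simp
    omega

/-- The balanced complete bipartite graph on `Fin n`, with the parts given by parity, together with the
edges from `0` to `2, 4, …, 2 * c`. -/
def starredTuran (n c : ℕ) : SimpleGraph (Fin n) :=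
  SimpleGraph.turanGraph n 2 ⊔
    SimpleGraph.fromRel fun u v => u.val = 0 ∧ v.val % 2 = 0 ∧ v.val ≤ 2 * c

theorem starredTuran_adj_of_mod_eq {n c : ℕ} {u v : Fin n} (h : (starredTuran n c).Adj u v)
    (huv : u.val % 2 = v.val % 2) :
    u ≠ v ∧ ((u.val = 0 ∧ v.val % 2 = 0 ∧ v.val ≤ 2 * c) ∨
      (v.val = 0 ∧ u.val % 2 = 0 ∧ u.val ≤ 2 * c)) := by
  rw [starredTuran, SimpleGraph.sup_adj, SimpleGraph.turanGraph_adj, SimpleGraph.fromRel_adj] at h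
  exact h.resolve_left (not_not.2 huv)

theorem le_card_edgeFinset_starredTuran {n c : ℕ} (hc : 2 * c < n) :
    n ^ 2 / 4 + c ≤ #(starredTuran n c).edgeFinset := by
  let φ : Fin c → Sym2 (Fin n) := fun i => s(⟨0, by omega⟩, ⟨2 * (i.val + 1), by omega⟩)
  have hφ : Function.Injective φ := by
    intro i j hij
    simp only [φ, Sym2.eq_iff, Fin.mk.injEq] at hij
    exact Fin.ext (by omega)
  have h1 : #(univ.image φ) = c := by
    rw [Finset.card_image_of_injective _ hφ, Finset.card_univ, Fintype.card_fin]
  refine le_trans (le_of_eq ?_) (Finset.card_le_card (?_ :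
    (SimpleGraph.turanGraph n 2).edgeFinset ∪ univ.image φ ⊆ (starredTuran n c).edgeFinset))
  · rw [Finset.card_union_of_disjoint ?_, h1, card_edgeFinset_turanGraph_two]
    rw [Finset.disjoint_left]
    intro e he he'
    rw [mem_image] at he'
    obtain ⟨i, -, rfl⟩ := he'
    simp only [φ, SimpleGraph.mem_edgeFinset, SimpleGraph.mem_edgeSet,
      SimpleGraph.turanGraph_adj] at he
    omega
  · refine Finset.union_subset ?_ ?_
    · exact SimpleGraph.edgeFinset_mono le_sup_left
    · intro e he
      rw [mem_image] at he
      obtain ⟨i, -, rfl⟩ := he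
      rw [SimpleGraph.mem_edgeFinset, SimpleGraph.mem_edgeSet, starredTuran, SimpleGraph.sup_adj]
      right
      simp only [SimpleGraph.fromRel_adj, ne_eq, Fin.mk.injEq]
      have := i.isLt
      exact ⟨by omega, .inl ⟨trivial, by omega, by omega⟩⟩

/-- A closed walk of odd length has an edge whose ends have the same parity. -/
theorem exists_adj_mod_eq {m n s L : ℕ} {G : SimpleGraph (Fin n)} (f : Fin m → Fin n)
    (hm : s + L < m) (hL : Even L)
    (hf : ∀ i (hi : i + 1 < m), G.Adj (f ⟨i, by omega⟩) (f ⟨i + 1, hi⟩))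
    (hclose : G.Adj (f ⟨s, by omega⟩) (f ⟨s + L, hm⟩)) :
    ∃ i j : Fin m, (s ≤ i.val ∧ i.val ≤ s + L) ∧ (s ≤ j.val ∧ j.val ≤ s + L) ∧
      G.Adj (f i) (f j) ∧ (f i).val % 2 = (f j).val % 2 := by
  by_contra! hcon
  have key : ∀ t (ht : t ≤ L), (f ⟨s + t, by omega⟩).val % 2 = ((f ⟨s, by omega⟩).val + t) % 2 := by
    intro t ht
    induction t with
    | zero => rfl
    | succ t ih =>
      have h1 := ih (by omega)
      have h2 := hcon ⟨s + t, by omega⟩ ⟨s + t + 1, by omega⟩ ⟨by simp, by simp; omega⟩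
        ⟨by simp; omega, by simp; omega⟩ (hf (s + t) (by omega))
      simp only [← add_assoc]
      omega
  have h1 := hcon ⟨s, by omega⟩ ⟨s + L, hm⟩ (by simp) (by simp) hclose
  have h2 := key L le_rfl
  obtain ⟨l, rfl⟩ := hL
  omega

/-- Each odd cycle in `starredTuran n c` has an edge from `0` to `2, …, 2 * c`. So two odd cycles share the
vertex `0`, and for `c = 1` they share the edge from `0` to `2`. -/
theorem free_starredTuran {r₁ r₂ q n c : ℕ} (hr₁ : 3 ≤ r₁) (hr₂ : 3 ≤ r₂) (hodd₁ : Odd r₁)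
    (hodd₂ : Odd r₂) (hqc : 1 ≤ q ∨ c ≤ 1) :
    (dumbbell r₁ r₂ q).Free (starredTuran n c) := by
  rintro ⟨φ⟩
  have hadj : ∀ i j : Fin (r₁ + r₂ + q - 1), i ≠ j → (i.val + 1 = j.val ∨
      (i.val = 0 ∧ j.val + 1 = r₁) ∨ (i.val + 1 = r₁ + q ∧ j.val + 2 = r₁ + r₂ + q)) →
      (starredTuran n c).Adj (φ i) (φ j) := by
    intro i j hij h
    exact φ.toHom.map_adj ((SimpleGraph.fromRel_adj _ _ _).2 ⟨hij, .inl h⟩)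
  have hpath : ∀ i (hi : i + 1 < r₁ + r₂ + q - 1),
      (starredTuran n c).Adj (φ ⟨i, by omega⟩) (φ ⟨i + 1, hi⟩) := fun i hi =>
    hadj _ _ (by simp) (.inl rfl)
  obtain ⟨i, j, hi, hj, hij, hmod⟩ := exists_adj_mod_eq (s := 0) (L := r₁ - 1) φ (by omega)
    (Nat.Odd.sub_odd hodd₁ odd_one) hpath
    (hadj _ _ (by simp; omega) (.inr (.inl ⟨rfl, by simp; omega⟩)))
  obtain ⟨i', j', hi', hj', hij', hmod'⟩ := exists_adj_mod_eq (s := r₁ - 1 + q) (L := r₂ - 1) φ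
    (by omega) (Nat.Odd.sub_odd hodd₂ odd_one) hpath
    (hadj _ _ (by simp; omega) (.inr (.inr ⟨by simp; omega, by simp; omega⟩)))
  have hinj : ∀ a b : Fin (r₁ + r₂ + q - 1), (φ a).val = (φ b).val → a.val = b.val :=
    fun a b h => congrArg Fin.val (φ.injective (Fin.ext h))
  obtain ⟨hne, h⟩ := starredTuran_adj_of_mod_eq hij hmod
  obtain ⟨hne', h'⟩ := starredTuran_adj_of_mod_eq hij' hmod'
  have hv : (φ i).val ≠ (φ j).val := fun h => hne (Fin.ext h)
  have hv' : (φ i').val ≠ (φ j').val := fun h => hne' (Fin.ext h)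
  have e1 := hinj i i'
  have e2 := hinj i j'
  have e3 := hinj j i'
  have e4 := hinj j j'
  have e5 := hinj i j
  have e6 : i.val = j.val → (φ i).val = (φ j).val := fun h => by rw [Fin.ext h]
  omega

theorem nat_floor_sq_div_four (n : ℕ) : ⌊(n : ℚ) ^ 2 / 4⌋₊ = n ^ 2 / 4 := by
  have := Nat.floor_div_eq_div (K := ℚ) (n ^ 2) 4
  push_cast at this
  exact this

theorem nat_ceil_div_two (n : ℕ) : ⌈(n : ℚ) / 2⌉₊ = (n + 1) / 2 := by
  apply le_antisymm
  · rw [Nat.ceil_le, div_le_iff₀ (by norm_num)]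
    have : n ≤ (n + 1) / 2 * 2 := by omega
    exact_mod_cast this
  · have h := Nat.le_ceil ((n : ℚ) / 2)
    rw [div_le_iff₀ (by norm_num)] at h
    have : n ≤ ⌈(n : ℚ) / 2⌉₊ * 2 := by exact_mod_cast h
    omega

/-! ### The extremal numbers -/

theorem theorem6 (r₁ r₂ q n k : ℕ) (hr₁ : 3 ≤ r₁) (hr : r₁ ≤ r₂)
    (hodd₁ : Odd r₁) (hodd₂ : Odd r₂)
    (hk : k = 3 * r₁ + 3 * r₂ + 2 * q - 11) (hn : k ^ 2 + k ≤ n) :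
    (q = 0 → SimpleGraph.extremalNumber n (dumbbell r₁ r₂ q) = ⌊(n : ℚ) ^ 2 / 4⌋₊ + 1) ∧
    (1 ≤ q → SimpleGraph.extremalNumber n (dumbbell r₁ r₂ q) =
      ⌊(n : ℚ) ^ 2 / 4⌋₊ + ⌈(n : ℚ) / 2⌉₊ - 1) := by
  have hr₂ : 3 ≤ r₂ := hr₁.trans hr
  have hbound : (2 * (r₁ + r₂ + q - 1) - 3) ^ 2 + (2 * (r₁ + r₂ + q - 1) - 3) ≤ n := by
    have : 2 * (r₁ + r₂ + q - 1) - 3 ≤ k := by omega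
    exact le_trans (by gcongr) hn
  have hk7 : 7 ≤ k := by omega
  have hn7 : 7 ≤ n := le_trans (by nlinarith) hn
  have hupper : ∀ m, (∀ G : SimpleGraph (Fin n), m + 1 ≤ #G.edgeFinset →
      SimpleGraph.IsContained (dumbbell r₁ r₂ q) G) →
      SimpleGraph.extremalNumber n (dumbbell r₁ r₂ q) ≤ m := by
    intro m hm
    rw [← Fintype.card_fin n, SimpleGraph.extremalNumber_le_iff]
    intro G _ hG
    by_contra! hlt
    exact hG (hm G (by convert! Nat.succ_le_of_lt hlt))
  have hlower : ∀ c, 2 * c < n → (1 ≤ q ∨ c ≤ 1) →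
      n ^ 2 / 4 + c ≤ SimpleGraph.extremalNumber n (dumbbell r₁ r₂ q) := by
    intro c hc hqc
    have := SimpleGraph.card_edgeFinset_le_extremalNumber
      (free_starredTuran (n := n) hr₁ hr₂ hodd₁ hodd₂ hqc)
    rw [Fintype.card_fin] at this
    exact (le_card_edgeFinset_starredTuran hc).trans this
  rw [nat_floor_sq_div_four, nat_ceil_div_two]
  constructor
  · rintro rfl
    refine le_antisymm (hupper _ fun G hG => ?_) (hlower 1 (by omega) (.inr le_rfl))
    exact isContained_of_card_edgeFinset_zero hr₁ hr₂ hodd₁ hodd₂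
      (by rwa [Fintype.card_fin]) (by rwa [Fintype.card_fin])
  · intro hq
    refine le_antisymm (hupper _ fun G hG => ?_) ?_
    · exact isContained_of_card_edgeFinset_pos hr₁ hr₂ hodd₁ hodd₂ hq
        (by rwa [Fintype.card_fin]) (by rw [Fintype.card_fin]; omega)
    · have := hlower ((n - 1) / 2) (by omega) (.inl hq)
      omega

end
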